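/- For $n\ge 1$ let $D_n$ be the doubly hexagonal chain of length $n$: the graph consisting of $n+1$ disjoint paths $a_ib_ic_id_i$ ($0\le i\le n$) together with the edges $a_{i-1}a_i$, $c_{i-1}b_i$, $d_{i-1}d_i$ ($1\le i\le n$). (Vertices of degree 2 that subdivide edges $a_{i-1}a_i$, $d_{i-1}d_i$ and complete the hexagons are suppressed.) Let $S=\{a_n,b_n,c_n,d_n\}$ and write $a,b,c,d$ for its elements. A (combinatorial, orientable) embedding of a graph is a rotation system, i.e. a choice of a cyclic permutation of the edges incident with each vertex. If it has $f$ facial walks, its genus is $g=1+\frac12(|E|-|V|-f)$. The genus polynomial of $D_n$ is $\alpha(D_n,Y)=\sum_{g\ge 0}\alpha_g Y^g$, where $\alpha_g$ is the number of embeddings of genus $g$. The $S$-type of an embedding of $D_n$ is the family of the cyclic sequences of vertices of $S$ along those facial walks that meet $S$, where a type is identified with the type obtained by reversing all its cyclic sequences. Put $$\tau_0=(ba)(abcd)(dcb),\quad \tau_1=(baabcd)(dcb),\quad \tau_2=(badcb)(abcd),$$ $$\tau_3=(ba)(abcddcb),\quad \tau_4=(baabcddcb),\quad \tau_5=(badcbabcd).$$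 For every $n\ge1$, every embedding of $D_n$ has exactly one of the $S$-types $\tau_0,\dots,\tau_5$. Let $\alpha(D_n,Y,S)$ be the vector whose entry at $\tau_i$ is $\sum_{g\ge0}\alpha_g(\tau_i)Y^g$, where $\alpha_g(\tau_i)$ is the number of embeddings of $D_n$ of genus $g$ and $S$-type $\tau_i$. Then $\alpha(D_1,Y,S)=(2,0,0,0,0,2Y)^T$, and for every $n\ge2$ $$\alpha(D_n,Y,S)=Q^{\,n-1}\,\alpha(D_1,Y,S),\qquad Q=\begin{pmatrix} 1&2&2&4&8&8\\ 6Y&4Y&4Y&8Y&0&0\\ 2Y&4Y&4Y&0&0&0\\ 2Y&4Y&4Y&0&0&0\\ 4Y^2&0&0&0&0&0\\ Y&2Y&2Y&4Y&8Y&8Y \end{pmatrix}.$$ Let $\widehat\alpha(D_n,Y,S)$ be the vector defined in the same way for the four types $\tau_0,\tau_{12},\tau_3,\tau_{45}$, where an embedding is of type $\tau_{12}$ if its $S$-type is $\tau_1$ or $\tau_2$, and of type $\tau_{45}$ if its $S$-type is $\tau_4$ or $\tau_5$. Then for every $n\ge1$ $$\widehat\alpha(D_n,Y,S)=\begin{pmatrix}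 1&2&4&8\\ 8Y&8Y&8Y&0\\ 2Y&4Y&0&0\\ 4Y^2+Y&2Y&4Y&8Y \end{pmatrix}^{n-1}\begin{pmatrix}2\\0\\0\\2Y\end{pmatrix},$$ and the genus polynomial $\alpha(D_n,Y)$ is the sum of the four entries of $\widehat\alpha(D_n,Y,S)$. In particular, the genus polynomials of $D_1,\dots,D_8$ are: - $D_1$: $2+2Y$ - $D_2$: $2+38Y+24Y^2$ - $D_3$: $2+102Y+664Y^2+256Y^3$ - $D_4$: $2+166Y+3032Y^2+10368Y^3+2816Y^4$ - $D_5$: $2+230Y+7448Y^2+70912Y^3+152832Y^4+30720Y^5$ - $D_6$: $2+294Y+13912Y^2+244096Y^3+1441536Y^4+2158592Y^5+335872Y^6$ - $D_7$: $2+358Y+22424Y^2+595456Y^3+6588672Y^4+26675200Y^5+29556736Y^6+3670016Y^7$ - $D_8$: $2+422Y+32984Y^2+1190528Y^3+20378368Y^4+155713536Y^5+461266944Y^6+395051008Y^7+40108032Y^8$ -/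

import Mathlib

open Polynomial

/-- Cyclic sequences: keep the entries on which `f` is defined, and apply `f` to them. -/
def Cycle.selectMap {α β : Type*} (f : α → Option β) : Cycle α → Cycle β :=
  Quotient.map' (List.filterMap f) fun _ _ h => by
    obtain ⟨n, rfl⟩ := h
    induction n with
    | zero => simp
    | succ n ih =>
      refine ih.trans ?_
      rw [← List.rotate_rotate]
      rcases List.rotate _ n with _ | ⟨a, l⟩
      · simp
      · rw [List.rotate_cons_succ, List.rotate_zero, List.filterMap_append, List.filterMap_cons]
        cases h : f a with
        | none => simpa [h] using List.IsRotated.refl _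
        | some b => exact ⟨1, by simp [h]⟩

namespace SimpleGraph

variable {V : Type*}

/-- A rotation system (combinatorial orientable embedding) of a simple graph: a cyclic permutation
of the edges at each vertex `v`; the edges at `v` are named by their other ends. -/
structure RotationSystem (G : SimpleGraph V) where
  rot : ∀ v, Equiv.Perm (G.neighborSet v)
  cyclic : ∀ v, (rot v).IsCycleOn Set.univ

namespace RotationSystem

variable {G : SimpleGraph V}

instance [Finite V] : Finite G.RotationSystem :=
  Finite.of_injective RotationSystem.rot fun P P' h => by
    cases P; cases P'; cases h; rfl

/-- Face traversal: having walked along the directed edge `u → v`, leave `v` by the edge that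
follows `vu` in the rotation at `v`. -/
def faceNext (P : G.RotationSystem) (e : G.Dart) : G.Dart :=
  ⟨(e.snd, (P.rot e.snd ⟨e.fst, e.adj.symm⟩ : V)),
    (P.rot e.snd ⟨e.fst, e.adj.symm⟩).2⟩

section

variable [Fintype V] [DecidableEq V] [DecidableRel G.Adj]

/-- The facial walks, as cyclic sequences of directed edges (each directed edge lies on
exactly one of them). -/
noncomputable def facialWalks (P : G.RotationSystem) : Finset (Cycle G.Dart) :=
  Finset.univ.image fun e => Function.periodicOrbit P.faceNext e

/-- The genus of an embedding of a connected graph with at least one edge, by Euler's formula. -/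
noncomputable def genus (P : G.RotationSystem) : ℚ :=
  1 + ((G.edgeFinset.card : ℚ) - (Fintype.card V : ℚ) - (P.facialWalks.card : ℚ)) / 2

/-- Let `S` be a set of vertices whose members carry names in `L`: `name v = none` if `v ∉ S`.
This is the family of the cyclic sequences of (names of) vertices of `S` along those facial walks
that meet `S`. -/
noncomputable def traces {L : Type*} [DecidableEq L] (name : V → Option L)
    (P : G.RotationSystem) : Multiset (Cycle L) :=
  (P.facialWalks.val.map (Cycle.selectMap fun e => name e.fst)).filter (· ≠ Cycle.nil)

/-- The embedding has `S`-type `τ`; a type and its reverse count as the same. -/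
def HasType {L : Type*} [DecidableEq L] (name : V → Option L) (τ : Multiset (Cycle L))
    (P : G.RotationSystem) : Prop :=
  P.traces name = τ ∨ P.traces name = τ.map Cycle.reverse

end

end RotationSystem

section

variable [Fintype V] [DecidableEq V] (G : SimpleGraph V) [DecidableRel G.Adj]

/-- The generating function `∑ g ≥ 0, N_g Y ^ g`, where `N_g` is the number of embeddings of
genus `g` with the property `p`. -/
noncomputable def genusGenFun (p : G.RotationSystem → Prop) : ℤ[X] :=
  ∑ᶠ g : ℕ, C (Nat.card {P : G.RotationSystem // P.genus = g ∧ p P} : ℤ) * X ^ g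

/-- The sum in `genusGenFun` is finite, so its coefficients are the intended numbers. -/
theorem genusGenFun_coeff (p : G.RotationSystem → Prop) (g : ℕ) :
    (G.genusGenFun p).coeff g =
      (Nat.card {P : G.RotationSystem // P.genus = g ∧ p P} : ℤ) := by
  have hfin : (Function.support fun g : ℕ =>
      C (Nat.card {P : G.RotationSystem // P.genus = g ∧ p P} : ℤ) * (X : ℤ[X]) ^ g).Finite := by
    have h1 : {g : ℕ | (g : ℚ) ∈ Set.range (fun P : G.RotationSystem => P.genus)}.Finite :=
      (Set.finite_range _).preimage (Nat.cast_injective.injOn)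
    refine h1.subset fun g hg => ?_
    by_contra hne
    apply hg
    have : IsEmpty {P : G.RotationSystem // P.genus = g ∧ p P} :=
      ⟨fun P => hne ⟨P.1, P.2.1⟩⟩
    simp
  rw [genusGenFun, finsum_eq_sum _ hfin, finsetSum_coeff]
  simp only [coeff_C_mul, coeff_X_pow, mul_ite, mul_one, mul_zero]
  rw [Finset.sum_ite_eq]
  split_ifs with h
  · rfl
  · rw [Set.Finite.mem_toFinset, Function.notMem_support] at h
    have h2 := congrArg (fun q : ℤ[X] => q.coeff g) h
    simpa using h2.symm

/-- The genus polynomial `∑ g ≥ 0, N_g Y ^ g`, where `N_g` is the number of embeddings of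
genus `g`. -/
noncomputable def genusPolynomial : ℤ[X] :=
  G.genusGenFun fun _ => True

end

end SimpleGraph

namespace DoublyHexagonal

open SimpleGraph

/-- The edges joining consecutive layers; `0, 1, 2, 3` stand for the vertices `a, b, c, d` of
the path `P₄`. They join `a` to the new `a`, `c` to the new `b`, and `d` to the new `d`. -/
def Link (x y : Fin 4) : Prop :=
  (x = 0 ∧ y = 0) ∨ (x = 2 ∧ y = 1) ∨ (x = 3 ∧ y = 3)

instance : DecidableRel Link := fun x y => by unfold Link; infer_instance

/-- The doubly hexagonal chain `D_n` (up to subdividing edges): the fasciagraph made of the layers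
`0, …, n`, each a path `P₄`, with consecutive layers joined according to `Link`. -/
def chain (n : ℕ) : SimpleGraph (Fin (n + 1) × Fin 4) where
  Adj p q :=
    (p.1 = q.1 ∧ ((p.2 : ℕ) + 1 = q.2 ∨ (q.2 : ℕ) + 1 = p.2)) ∨
    ((p.1 : ℕ) + 1 = q.1 ∧ Link p.2 q.2) ∨
    ((q.1 : ℕ) + 1 = p.1 ∧ Link q.2 p.2)
  symm := ⟨fun p q h => by
    rcases h with ⟨h, h'⟩ | h | h
    · exact Or.inl ⟨h.symm, h'.symm⟩
    · exact Or.inr (Or.inr h)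
    · exact Or.inr (Or.inl h)⟩
  loopless := ⟨fun p h => by
    rcases h with ⟨_, h⟩ | ⟨h, _⟩ | ⟨h, _⟩ <;> omega⟩

instance (n : ℕ) : DecidableRel (chain n).Adj := fun p q => by
  unfold chain; infer_instance

/-- The set `S` of the vertices in the last layer of `D_n`, named `a, b, c, d`. -/
def name (n : ℕ) (p : Fin (n + 1) × Fin 4) : Option (Fin 4) :=
  if p.1 = Fin.last n then some p.2 else none

/-- The six `S`-types, in this order:
`(ba)(abcd)(dcb)`, `(baabcd)(dcb)`, `(badcb)(abcd)`, `(ba)(abcddcb)`, `(baabcddcb)`,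
`(badcbabcd)`. -/
def stype : Fin 6 → Multiset (Cycle (Fin 4)) :=
  ![{Cycle.ofList [1, 0], Cycle.ofList [0, 1, 2, 3], Cycle.ofList [3, 2, 1]},
    {Cycle.ofList [1, 0, 0, 1, 2, 3], Cycle.ofList [3, 2, 1]},
    {Cycle.ofList [1, 0, 3, 2, 1], Cycle.ofList [0, 1, 2, 3]},
    {Cycle.ofList [1, 0], Cycle.ofList [0, 1, 2, 3, 3, 2, 1]},
    {Cycle.ofList [1, 0, 0, 1, 2, 3, 3, 2, 1]},
    {Cycle.ofList [1, 0, 3, 2, 1, 0, 1, 2, 3]}]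

/-- The embedding of `D_n` has the `i`-th `S`-type. -/
def IsOfType (n : ℕ) (i : Fin 6) (P : (chain n).RotationSystem) : Prop :=
  P.HasType (name n) (stype i)

/-- The stratified genus distribution of `D_n`, a vector of polynomials indexed by the types. -/
noncomputable def stratified (n : ℕ) : Fin 6 → ℤ[X] := fun i =>
  (chain n).genusGenFun (IsOfType n i)

/-- The merged types: types 1 and 2 are put together, and so are types 4 and 5. -/
def merged : Fin 4 → Finset (Fin 6) := ![{0}, {1, 2}, {3}, {4, 5}]

/-- The stratified genus distribution of `D_n` with respect to the merged types. -/
noncomputable def reduced (n : ℕ) : Fin 4 → ℤ[X] := fun j =>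
  (chain n).genusGenFun fun P => ∃ i ∈ merged j, IsOfType n i P

/-- The transfer matrix. -/
noncomputable def Q : Matrix (Fin 6) (Fin 6) ℤ[X] :=
  !![1,         2,     2,     4,     8,     8;
     6 * X,     4 * X, 4 * X, 8 * X, 0,     0;
     2 * X,     4 * X, 4 * X, 0,     0,     0;
     2 * X,     4 * X, 4 * X, 0,     0,     0;
     4 * X ^ 2, 0,     0,     0,     0,     0;
     X,         2 * X, 2 * X, 4 * X, 8 * X, 8 * X]

/-- The reduced transfer matrix. -/
noncomputable def Qred : Matrix (Fin 4) (Fin 4) ℤ[X] :=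
  !![1,             2,     4,     8;
     8 * X,         8 * X, 8 * X, 0;
     2 * X,         4 * X, 0,     0;
     4 * X ^ 2 + X, 2 * X, 4 * X, 8 * X]

end DoublyHexagonal

/-!
An embedding of `D_n` is the same as a free choice of one of two orientations at each vertex of
degree three (`orientationsEquiv`); vertices of degree two offer no choice. The facial walks are the
orbits of the face traversal, and they are followed while the layers are swept from the lowest to
the last.

Suppose the face traversal enters the layers `0, …, i` from above, along one of the three edges
leading down from layer `i + 1`. It leaves them again along one of the three edges leading up, and
this defines a bijection between three entrances and three exits. This bijection, one of six
*states*, and the number of facial walks that stay inside the layers `0, …, i` are all that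
influences the rest of the facial walks (`StateAt`). The state and the number of newly closed facial
walks after the next layer are a function of the state before and of the four orientations in that
layer (`StateAt.succ`); it is computed by deleting the directed edges below the new layer one after
the other from the first return map, which closes an orbit exactly when a directed edge returns to
itself (`contract_spec`). In the last layer one reads off the traces of the facial walks meeting
`S`, which gives the type (`StateAt.last`).

By Euler's formula each layer makes a contribution to the genus that depends on the same data, so
the generating functions are iterated sums over the layers. Write `E` for the matrix taking a state
to the two types that the orientations of the last layer produce, and `T` for the transfer matrix of
the states. The relation `E * T = Q * E`, which is `sum_step_lastVector`, then yields the powers of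
`Q`; summing the rows of merged types gives `Qred` (`sum_merged_mulVec`).
-/

open Polynomial

/-! ### First returns and closed orbits -/

namespace FaceTracing

open Function

section Reach

variable {D : Type*} {f : D → D} {U V : Set D} {x y z : D}

/-- Iterating `f` at least once from `x`, one arrives at `y`, and all points strictly in between
lie in `U`. If `y ∉ U`, then `y` is the first point outside `U` met after `x`. -/
def Reach (f : D → D) (U : Set D) (x y : D) : Prop :=
  ∃ m, f^[m + 1] x = y ∧ ∀ k < m, f^[k + 1] x ∈ U

theorem Reach.single (f : D → D) (U : Set D) (x : D) : Reach f U x (f x) :=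
  ⟨0, rfl, by simp⟩

theorem Reach.mono (hUV : U ⊆ V) (h : Reach f U x y) : Reach f V x y := by
  obtain ⟨m, h1, h2⟩ := h
  exact ⟨m, h1, fun k hk => hUV (h2 k hk)⟩

theorem Reach.trans (h : Reach f U x y) (hy : y ∈ U) (h' : Reach f U y z) : Reach f U x z := by
  obtain ⟨m, rfl, h2⟩ := h
  obtain ⟨m', rfl, h2'⟩ := h'
  refine ⟨m' + (m + 1), by rw [← iterate_add_apply]; congr 1; omega, fun k hk => ?_⟩
  rcases lt_trichotomy k m with hkm | rfl | hkm
  · exact h2 k hkm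
  · exact hy
  · have := h2' (k - (m + 1)) (by omega)
    rw [← iterate_add_apply] at this
    convert this using 2
    omega

theorem Reach.unique (h : Reach f U x y) (hy : y ∉ U) (h' : Reach f U x z) (hz : z ∉ U) :
    y = z := by
  obtain ⟨m, rfl, h2⟩ := h
  obtain ⟨m', rfl, h2'⟩ := h'
  rcases lt_trichotomy m m' with hm | rfl | hm
  · exact absurd (h2' m hm) hy
  · rfl
  · exact absurd (h2 m' hm) hz

theorem Reach.unique_left (hf : Injective f) (h : Reach f U x z) (hx : x ∉ U)
    (h' : Reach f U y z) (hy : y ∉ U) : x = y := by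
  obtain ⟨m, h1, h2⟩ := h
  obtain ⟨m', h1', h2'⟩ := h'
  rcases lt_trichotomy m m' with hm | rfl | hm
  · refine absurd (h2' (m' - m - 1) (by omega)) ?_
    have : f^[m + 1] (f^[m' - m] y) = f^[m + 1] x := by
      rw [h1, ← h1', ← iterate_add_apply]; congr 1; omega
    rw [show m' - m - 1 + 1 = m' - m by omega, hf.iterate _ this]
    exact hx
  · exact hf.iterate _ (h1.trans h1'.symm)
  · refine absurd (h2 (m - m' - 1) (by omega)) ?_
    have : f^[m' + 1] (f^[m - m'] x) = f^[m' + 1] y := by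
      rw [h1', ← h1, ← iterate_add_apply]; congr 1; omega
    rw [show m - m' - 1 + 1 = m - m' by omega, hf.iterate _ this]
    exact hy

end Reach

section Orbits

variable {D : Type*} [Finite D] {f : D → D} {U : Set D} {x y : D}

theorem mem_periodicOrbit_self (hf : Injective f) (x : D) : x ∈ periodicOrbit f x :=
  (mem_periodicOrbit_iff (hf.mem_periodicPts x)).2 ⟨0, rfl⟩

theorem periodicOrbit_eq_of_mem (hf : Injective f) (h : y ∈ periodicOrbit f x) :
    periodicOrbit f y = periodicOrbit f x := by
  obtain ⟨n, rfl⟩ := (mem_periodicOrbit_iff (hf.mem_periodicPts x)).1 h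
  exact periodicOrbit_apply_iterate_eq (hf.mem_periodicPts x) n

theorem reach_self_iff (hf : Injective f) :
    Reach f U x x ↔ ∀ y ∈ periodicOrbit f x, y ∈ insert x U := by
  have hx := hf.mem_periodicPts x
  constructor
  · rintro ⟨m, h1, h2⟩ y hy
    obtain ⟨n, rfl⟩ := (mem_periodicOrbit_iff hx).1 hy
    have hp : IsPeriodicPt f (m + 1) x := h1
    rw [← hp.iterate_mod_apply n]
    rcases h : n % (m + 1) with _ | k
    · exact Set.mem_insert _ _
    · have : n % (m + 1) < m + 1 := Nat.mod_lt n (Nat.succ_pos m)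
      exact Set.mem_insert_of_mem _ (h2 k (by omega))
  · intro h
    have hpos := minimalPeriod_pos_of_mem_periodicPts hx
    refine ⟨minimalPeriod f x - 1, ?_, fun k hk => ?_⟩
    · rw [Nat.sub_add_cancel hpos]; exact iterate_minimalPeriod
    · refine (h _ ((mem_periodicOrbit_iff hx).2 ⟨k + 1, rfl⟩)).resolve_left fun heq => ?_
      have := IsPeriodicPt.minimalPeriod_le (Nat.succ_pos k)
        (show IsPeriodicPt f (k + 1) x from heq)
      omega

/-- The orbits of `f` that lie entirely in `U`. -/
def closedOrbits (f : D → D) (U : Set D) : Set (Cycle D) :=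
  {c | c ∈ Set.range (periodicOrbit f) ∧ ∀ y ∈ c, y ∈ U}

theorem closedOrbits_finite (f : D → D) (U : Set D) : (closedOrbits f U).Finite :=
  (Set.finite_range (periodicOrbit f)).subset fun _ h => h.1

theorem closedOrbits_empty (hf : Injective f) : closedOrbits f ∅ = ∅ := by
  ext c
  simp only [closedOrbits, Set.mem_ofPred_eq, Set.mem_empty_iff_false, iff_false, not_and]
  rintro ⟨x, rfl⟩ h
  exact h x (mem_periodicOrbit_self hf x)

open Classical in
/-- Adding a point closes at most one more orbit, namely its own. -/
theorem ncard_closedOrbits_insert (hf : Injective f) (hx : x ∉ U) :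
    (closedOrbits f (insert x U)).ncard =
      (closedOrbits f U).ncard + if Reach f U x x then 1 else 0 := by
  have key : ∀ c ∈ Set.range (periodicOrbit f), x ∈ c → c = periodicOrbit f x := by
    rintro _ ⟨y, rfl⟩ h
    exact (periodicOrbit_eq_of_mem hf h).symm
  split_ifs with h
  · have : closedOrbits f (insert x U) = insert (periodicOrbit f x) (closedOrbits f U) := by
      ext c
      constructor
      · rintro ⟨hc, hU⟩
        by_cases hxc : x ∈ c
        · exact Or.inl (key c hc hxc)
        · exact Or.inr ⟨hc, fun y hy => (hU y hy).resolve_left fun e => hxc (e ▸ hy)⟩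
      · rintro (rfl | ⟨hc, hU⟩)
        · exact ⟨⟨x, rfl⟩, (reach_self_iff hf).1 h⟩
        · exact ⟨hc, fun y hy => Or.inr (hU y hy)⟩
    rw [this, Set.ncard_insert_of_notMem _ (closedOrbits_finite f U)]
    exact fun h' => hx (h'.2 x (mem_periodicOrbit_self hf x))
  · congr 1
    ext c
    constructor
    · rintro ⟨hc, hU⟩
      have hxc : x ∉ c := fun hxc => h ((reach_self_iff hf).2 (key c hc hxc ▸ hU))
      exact ⟨hc, fun y hy => (hU y hy).resolve_left fun e => hxc (e ▸ hy)⟩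
    · rintro ⟨hc, hU⟩
      exact ⟨hc, fun y hy => Or.inr (hU y hy)⟩

end Orbits

/-! ### Contracting points out of a list of first returns -/

section Contract

variable {κ : Type*}

/-- Each pair `(x, y)` in the list means that `y` is the first return of `x`. Delete the first `n`
sources one after the other, bypassing each of them, and count the loops that are closed up. -/
def contract [DecidableEq κ] : ℕ → List (κ × κ) → List (κ × κ) × ℕ
  | 0, l => (l, 0)
  | _ + 1, [] => ([], 0)
  | n + 1, (x, y) :: l =>
    let r := contract n (l.map fun e => (e.1, if e.2 = x then y else e.2))
    (r.1, r.2 + if x = y then 1 else 0)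

/-- Bring the pairs whose sources belong to `xs` to the front and contract them. -/
def contractAt [DecidableEq κ] (xs : List κ) (l : List (κ × κ)) : List (κ × κ) × ℕ :=
  let l' := l.filter (·.1 ∈ xs)
  contract l'.length (l' ++ l.filter (·.1 ∉ xs))

variable {D : Type*} {f : D → D} {L : κ → D} {U : Set D} {l : List (κ × κ)}

/-- The list `l` of pairs of codes, decoded by `L`, records first returns with respect to the
complement of `U`; its sources are distinct. -/
structure Records (f : D → D) (L : κ → D) (U : Set D) (l : List (κ × κ)) : Prop where
  reach : ∀ e ∈ l, Reach f U (L e.1) (L e.2)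
  nodup : (l.map fun e => L e.1).Nodup
  src : ∀ e ∈ l, L e.1 ∉ U
  tgt : ∀ e ∈ l, L e.2 ∉ U

theorem Records.perm {l' : List (κ × κ)} (h : Records f L U l) (hl : l.Perm l') :
    Records f L U l' where
  reach e he := h.reach e (hl.mem_iff.2 he)
  nodup := (hl.map _).nodup_iff.1 h.nodup
  src e he := h.src e (hl.mem_iff.2 he)
  tgt e he := h.tgt e (hl.mem_iff.2 he)

/-- Each deletion keeps track of first returns and of the orbits that have become closed. -/
theorem contract_spec [DecidableEq κ] [Finite D] (hf : Injective f) {K : Set κ}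
    (hL : Set.InjOn L K) (n : ℕ) :
    ∀ (U : Set D) (l : List (κ × κ)), (∀ e ∈ l, e.1 ∈ K ∧ e.2 ∈ K) → Records f L U l →
      Records f L (U ∪ {d | d ∈ (l.take n).map fun e => L e.1}) (contract n l).1 ∧
      (closedOrbits f (U ∪ {d | d ∈ (l.take n).map fun e => L e.1})).ncard =
        (closedOrbits f U).ncard + (contract n l).2 := by
  induction n with
  | zero => intro U l _ h; simpa [contract] using h
  | succ n ih =>
    intro U l hK h
    rcases l with _ | ⟨⟨x, y⟩, l⟩
    · simpa [contract] using h
    have hx : L x ∉ U := h.src (x, y) (by simp)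
    have hxK : x ∈ K := (hK (x, y) (by simp)).1
    have hyK : y ∈ K := (hK (x, y) (by simp)).2
    have hxy : Reach f U (L x) (L y) := h.reach (x, y) (by simp)
    have hy : L y ∉ U := h.tgt (x, y) (by simp)
    have hnd := h.nodup
    rw [List.map_cons, List.nodup_cons] at hnd
    have hne : ∀ e ∈ l, L e.1 ≠ L x := fun e he heq =>
      hnd.1 (List.mem_map.2 ⟨e, he, heq⟩)
    have hstep : Records f L (insert (L x) U)
        (l.map fun e => (e.1, if e.2 = x then y else e.2)) := by
      refine ⟨?_, ?_, ?_, ?_⟩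
      · simp only [List.mem_map, forall_exists_index, and_imp, forall_apply_eq_imp_iff₂]
        intro e he
        have hr := (h.reach e (by simp [he])).mono (Set.subset_insert (L x) U)
        split_ifs with hex
        · rw [hex] at hr
          exact hr.trans (Set.mem_insert _ _) (hxy.mono (Set.subset_insert _ _))
        · exact hr
      · simpa [Function.comp_def] using hnd.2
      · simp only [List.mem_map, forall_exists_index, and_imp, forall_apply_eq_imp_iff₂]
        rintro e he (h' | h')
        · exact hne e he h'
        · exact h.src e (by simp [he]) h'
      · simp only [List.mem_map, forall_exists_index, and_imp, forall_apply_eq_imp_iff₂]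
        intro e he
        have het := h.tgt e (by simp [he])
        split_ifs with hex
        · rintro (h' | h')
          -- `x` would be its own first return, hence not that of the other point `e.1`
          · have hr := h.reach e (by simp [he])
            rw [hex, ← h'] at hr
            exact hne e he (hr.unique_left hf (h.src e (by simp [he])) hxy hx)
          · exact hy h'
        · rintro (h' | h')
          · exact hex (hL (hK e (by simp [he])).2 hxK h')
          · exact het h'
    have hK' : ∀ e ∈ l.map (fun e => (e.1, if e.2 = x then y else e.2)), e.1 ∈ K ∧ e.2 ∈ K := by
      simp only [List.mem_map, forall_exists_index, and_imp, forall_apply_eq_imp_iff₂]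
      intro e he
      refine ⟨(hK e (by simp [he])).1, ?_⟩
      split_ifs
      · exact hyK
      · exact (hK e (by simp [he])).2
    obtain ⟨h1, h2⟩ := ih _ _ hK' hstep
    have hset : insert (L x) U ∪ {d | d ∈ ((l.map fun e =>
          (e.1, if e.2 = x then y else e.2)).take n).map fun e => L e.1} =
        U ∪ {d | d ∈ (((x, y) :: l).take (n + 1)).map fun e => L e.1} := by
      ext d
      simp only [Set.mem_union, Set.mem_insert_iff, Set.mem_ofPred_eq, List.take_succ_cons,
        List.map_cons, List.mem_cons, ← List.map_take, List.map_map, Function.comp_def]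
      tauto
    rw [hset] at h1 h2
    refine ⟨h1, ?_⟩
    rw [h2, ncard_closedOrbits_insert hf hx]
    have : Reach f U (L x) (L x) ↔ x = y := by
      constructor
      · exact fun hr => hL hxK hyK (hr.unique hx hxy hy)
      · rintro rfl; exact hxy
    simp only [contract, this]
    omega

theorem contractAt_spec [DecidableEq κ] [Finite D] (hf : Injective f) {K : Set κ}
    (hL : Set.InjOn L K) (xs : List κ)
    (hK : ∀ e ∈ l, e.1 ∈ K ∧ e.2 ∈ K) (h : Records f L U l)
    (hxs : ∀ x ∈ xs, x ∈ l.map Prod.fst) :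
    Records f L (U ∪ L '' {x | x ∈ xs}) (contractAt xs l).1 ∧
      (closedOrbits f (U ∪ L '' {x | x ∈ xs})).ncard =
        (closedOrbits f U).ncard + (contractAt xs l).2 := by
  have hp : (l.filter (·.1 ∈ xs) ++ l.filter (·.1 ∉ xs)).Perm l := by
    simpa using List.filter_append_perm (fun e : κ × κ => decide (e.1 ∈ xs)) l
  have := contract_spec hf hL (l.filter (·.1 ∈ xs)).length U _
    (fun e he => hK e (hp.mem_iff.1 he)) (h.perm hp.symm)
  have hset : {d | d ∈ ((l.filter (·.1 ∈ xs) ++ l.filter (·.1 ∉ xs)).take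
      (l.filter (·.1 ∈ xs)).length).map fun e => L e.1} = L '' {x | x ∈ xs} := by
    rw [List.take_left]
    ext d
    simp only [List.mem_map, List.mem_filter, decide_eq_true_eq, Set.mem_ofPred_eq, Set.mem_image]
    constructor
    · rintro ⟨e, ⟨_, h2⟩, rfl⟩
      exact ⟨e.1, h2, rfl⟩
    · rintro ⟨x, hx, rfl⟩
      obtain ⟨e, he, rfl⟩ := List.mem_map.1 (hxs x hx)
      exact ⟨e, ⟨he, hx⟩, rfl⟩
  rw [hset] at this
  exact this

end Contract

/-! ### Reading off the traces of orbits -/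

section Trace

variable {κ D Λ : Type*} {f : D → D} {L : κ → D} {U : Set D}

open Classical in
theorem Reach.filter_iterate {x y : D} (h : Reach f U x y) (hx : x ∉ U) :
    ∃ M, 0 < M ∧ f^[M] x = y ∧ (List.iterate f x M).filter (· ∉ U) = [x] := by
  obtain ⟨m, h1, h2⟩ := h
  refine ⟨m + 1, Nat.succ_pos m, h1, ?_⟩
  rw [List.iterate, List.filter_cons_of_pos (by simpa using hx)]
  congr 1
  rw [List.filter_eq_nil_iff, ← List.range_map_iterate]
  simp only [List.mem_map, List.mem_range, decide_eq_true_eq, not_not, forall_exists_index, and_imp,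
    forall_apply_eq_imp_iff₂]
  exact fun k hk => h2 k hk

open Classical in
theorem filter_iterate_of_isChain (t : List D) : ∀ (x z : D),
    (x :: (t ++ [z])).IsChain (Reach f U) → (∀ d ∈ x :: t, d ∉ U) →
    ∃ M, 0 < M ∧ f^[M] x = z ∧ (List.iterate f x M).filter (· ∉ U) = x :: t := by
  induction t with
  | nil =>
    intro x z h hU
    simp only [List.nil_append, List.isChain_cons_cons] at h
    exact h.1.filter_iterate (hU x (by simp))
  | cons y t ih =>
    intro x z h hU
    rw [List.cons_append, List.isChain_cons_cons] at h
    obtain ⟨M, h0, h1, h2⟩ := h.1.filter_iterate (hU x (by simp))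
    obtain ⟨M', h0', h1', h2'⟩ := ih y z h.2 fun d hd => hU d (List.mem_cons_of_mem _ hd)
    refine ⟨M + M', by omega, by rw [Nat.add_comm, iterate_add_apply, h1, h1'], ?_⟩
    rw [List.iterate_add, List.filter_append, h2, h1, h2', List.singleton_append]

open Classical in
/-- If the points outside `U` met in succession after `x` are those of `t`, and then `x` again,
then the orbit of `x` is represented by a list in which `x :: t` are the points outside `U`. -/
theorem periodicOrbit_eq_of_isChain [Finite D] (hf : Injective f) {x : D} {t : List D}
    (h : (x :: (t ++ [x])).IsChain (Reach f U)) (hU : ∀ d ∈ x :: t, d ∉ U)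
    (hnd : (x :: t).Nodup) :
    ∃ l : List D, periodicOrbit f x = Cycle.ofList l ∧ l.filter (· ∉ U) = x :: t := by
  obtain ⟨M, h0, h1, h2⟩ := filter_iterate_of_isChain t x x h hU
  have hp : IsPeriodicPt f M x := h1
  have hpos := minimalPeriod_pos_of_mem_periodicPts (hf.mem_periodicPts x)
  have hle := hp.minimalPeriod_le h0
  have hmem : ∀ {k}, 0 < k → x ∈ (List.iterate f x k).filter (· ∉ U) := by
    intro k hk
    rcases k with _ | k
    · omega
    · exact List.mem_filter.2 ⟨by simp [List.iterate], by simpa using hU x (by simp)⟩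
  -- a second round would pass `x` again, but `x` occurs only once in `x :: t`
  have hM : M = minimalPeriod f x := by
    by_contra hne
    obtain ⟨k, hk⟩ := Nat.exists_eq_add_of_le hle
    rw [← h2, hk, List.iterate_add, List.filter_append, iterate_minimalPeriod] at hnd
    exact (List.disjoint_of_nodup_append hnd) (hmem hpos) (hmem (by omega))
  refine ⟨List.iterate f x M, ?_, h2⟩
  rw [periodicOrbit, List.range_map_iterate, hM]

theorem selectMap_ofList (nm : D → Option Λ) (l : List D) :
    Cycle.selectMap nm (Cycle.ofList l) = Cycle.ofList (l.filterMap nm) := rfl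

theorem selectMap_eq_nil {nm : D → Option Λ} {c : Cycle D} (h : ∀ d ∈ c, nm d = none) :
    Cycle.selectMap nm c = Cycle.nil := by
  induction c using Quotient.inductionOn' with
  | h l =>
    have : l.filterMap nm = [] := List.filterMap_eq_nil_iff.2 h
    exact congrArg Cycle.ofList this

/-- The orbit of the first point of a list of codes. -/
noncomputable def headOrbit (f : D → D) (L : κ → D) : List κ → Cycle D
  | [] => Cycle.nil
  | x :: _ => periodicOrbit f (L x)

theorem headOrbit_spec [Finite D] (hf : Injective f) {nm : D → Option Λ} {lab : κ → Λ}
    {l : List κ} (hl : l ≠ [])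
    (h : (l ++ [l.head hl]).IsChain fun a b => Reach f {d | nm d = none} (L a) (L b))
    (hlab : ∀ a ∈ l, nm (L a) = some (lab a)) (hnd : (l.map L).Nodup) :
    headOrbit f L l ∈ Set.range (periodicOrbit f) ∧
    Cycle.selectMap nm (headOrbit f L l) = Cycle.ofList (l.map lab) ∧
    ∀ d, nm d ≠ none → (d ∈ headOrbit f L l ↔ d ∈ l.map L) := by
  classical
  rcases l with _ | ⟨x, t⟩
  · exact absurd rfl hl
  have hU : ∀ d ∈ L x :: t.map L, d ∉ {d | nm d = none} := by
    intro d hd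
    rw [← List.map_cons] at hd
    obtain ⟨a, ha, rfl⟩ := List.mem_map.1 hd
    simp [hlab a ha]
  have hc : (L x :: (t.map L ++ [L x])).IsChain (Reach f {d | nm d = none}) := by
    have := List.isChain_map_of_isChain (S := Reach f {d | nm d = none}) L (fun _ _ hab => hab) h
    simpa using this
  obtain ⟨o, ho, hfil⟩ := periodicOrbit_eq_of_isChain hf hc hU (by simpa using hnd)
  refine ⟨⟨_, rfl⟩, ?_, fun d hd => ?_⟩
  · rw [headOrbit, ho, selectMap_ofList]
    congr 1
    have : o.filterMap nm = (L x :: t.map L).filterMap nm := by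
      rw [← hfil, List.filterMap_filter]
      refine List.filterMap_congr fun d _ => ?_
      by_cases hd : nm d = none <;> simp [hd]
    rw [this, ← List.map_cons, List.filterMap_map, ← List.filterMap_eq_map]
    exact List.filterMap_congr fun a ha => hlab a ha
  · rw [headOrbit, ho]
    change d ∈ o ↔ _
    rw [List.map_cons, ← hfil, List.mem_filter]
    simp [hd]

/-- If every point outside `U = {d | nm d = none}` lies on exactly one of the cyclic lists `cs` of
first returns, then these lists give the traces of all orbits, and the orbits are counted by
`cs` together with the orbits inside `U`. -/
theorem orbits_trace [Finite D] [DecidableEq Λ] (hf : Injective f) {W : Finset (Cycle D)}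
    (hW : ∀ c, c ∈ W ↔ c ∈ Set.range (periodicOrbit f)) {nm : D → Option Λ} {lab : κ → Λ}
    {cs : List (List κ)} (hne : ∀ l ∈ cs, l ≠ [])
    (h : ∀ l (hl : l ∈ cs), (l ++ [l.head (hne l hl)]).IsChain
      fun a b => Reach f {d | nm d = none} (L a) (L b))
    (hlab : ∀ a ∈ cs.flatten, nm (L a) = some (lab a)) (hnd : (cs.flatten.map L).Nodup)
    (hsurj : ∀ d, nm d ≠ none → d ∈ cs.flatten.map L) :
    W.card =
      (closedOrbits f {d | nm d = none}).ncard + cs.length ∧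
    (W.val.map (Cycle.selectMap nm)).filter (· ≠ Cycle.nil) =
      ((cs.map fun l => Cycle.ofList (l.map lab) : List (Cycle Λ)) : Multiset (Cycle Λ)) := by
  have hspec : ∀ l ∈ cs, _ := fun l hl => headOrbit_spec hf (hne l hl) (h l hl)
    (fun a ha => hlab a (List.mem_flatten.2 ⟨l, hl, ha⟩)) (by
      rw [List.map_flatten, List.nodup_flatten] at hnd
      exact hnd.1 _ (List.mem_map.2 ⟨l, hl, rfl⟩))
  have hdisj : cs.Pairwise fun l l' => List.Disjoint (l.map L) (l'.map L) := by
    rw [List.map_flatten, List.nodup_flatten, List.pairwise_map] at hnd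
    exact hnd.2
  have hnm : ∀ l ∈ cs, ∀ a ∈ l, nm (L a) ≠ none := fun l hl a ha => by
    simp [hlab a (List.mem_flatten.2 ⟨l, hl, ha⟩)]
  have hnd' : (cs.map (headOrbit f L)).Nodup := by
    rw [List.Nodup, List.pairwise_map]
    refine hdisj.imp_of_mem fun {l l'} hl hl' hd heq => ?_
    obtain ⟨a, ha⟩ := List.exists_mem_of_ne_nil l (hne l hl)
    have hLa : L a ∈ l.map L := List.mem_map.2 ⟨a, ha, rfl⟩
    refine hd hLa (((hspec l' hl').2.2 _ (hnm l hl a ha)).1 ?_)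
    rw [← heq]
    exact ((hspec l hl).2.2 _ (hnm l hl a ha)).2 hLa
  classical
  set C := W.filter fun c => ∀ d ∈ c, nm d = none
  have hC : (closedOrbits f {d | nm d = none}).ncard = C.card := by
    rw [← Set.ncard_coe_finset]
    congr 1
    ext c
    simp [closedOrbits, C, hW]
  have hWC : W.val = C.val + ((cs.map (headOrbit f L) : List (Cycle D)) : Multiset (Cycle D)) := by
    refine (Multiset.Nodup.ext W.nodup ?_).2 fun c => ?_
    · refine Multiset.nodup_add.2 ⟨C.nodup, hnd', ?_⟩
      rw [Multiset.disjoint_left]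
      intro c hc hc'
      obtain ⟨l, hl, rfl⟩ := List.mem_map.1 (Multiset.mem_coe.1 hc')
      obtain ⟨a, ha⟩ := List.exists_mem_of_ne_nil l (hne l hl)
      refine hnm l hl a ha ((Finset.mem_filter.1 hc).2 _ ?_)
      exact ((hspec l hl).2.2 _ (hnm l hl a ha)).2 (List.mem_map.2 ⟨a, ha, rfl⟩)
    · rw [Multiset.mem_add, Multiset.mem_coe, List.mem_map]
      simp only [Finset.mem_val]
      constructor
      · intro hc
        by_cases hcn : ∀ d ∈ c, nm d = none
        · exact Or.inl (Finset.mem_filter.2 ⟨hc, hcn⟩)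
        · push Not at hcn
          obtain ⟨d, hd, hdn⟩ := hcn
          obtain ⟨l, hl, hdl⟩ : ∃ l ∈ cs, d ∈ l.map L := by
            have := hsurj d hdn
            rw [List.map_flatten, List.mem_flatten] at this
            obtain ⟨l', hl', hd'⟩ := this
            obtain ⟨l, hl, rfl⟩ := List.mem_map.1 hl'
            exact ⟨l, hl, hd'⟩
          refine Or.inr ⟨l, hl, ?_⟩
          obtain ⟨y, rfl⟩ := (hW c).1 hc
          obtain ⟨y', hy'⟩ := (hspec l hl).1
          have hd' := ((hspec l hl).2.2 d hdn).2 hdl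
          rw [← hy'] at hd' ⊢
          exact (periodicOrbit_eq_of_mem hf hd').symm.trans (periodicOrbit_eq_of_mem hf hd)
      · rintro (hc | ⟨l, hl, rfl⟩)
        · exact (Finset.mem_filter.1 hc).1
        · obtain ⟨y, hy⟩ := (hspec l hl).1
          exact (hW _).2 ⟨y, hy⟩
  constructor
  · rw [hC, Finset.card_def, hWC, Multiset.card_add, Multiset.coe_card, List.length_map]
    rfl
  · rw [hWC, Multiset.map_add, Multiset.filter_add]
    have h1 : (C.val.map (Cycle.selectMap nm)).filter (· ≠ Cycle.nil) = 0 := by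
      refine Multiset.filter_eq_nil.2 fun c hc => ?_
      obtain ⟨c', hc', rfl⟩ := Multiset.mem_map.1 hc
      exact not_not.2 (selectMap_eq_nil (Finset.mem_filter.1 hc').2)
    have h2 : ((cs.map (headOrbit f L) : List (Cycle D)) : Multiset (Cycle D)).map
        (Cycle.selectMap nm) = ((cs.map fun l => Cycle.ofList (l.map lab) : List (Cycle Λ)) :
          Multiset (Cycle Λ)) := by
      rw [Multiset.map_coe, List.map_map]
      congr 1
      exact List.map_congr_left fun l hl => (hspec l hl).2.1
    rw [h1, h2, zero_add, Multiset.filter_eq_self]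
    intro c hc
    obtain ⟨l, hl, rfl⟩ := List.mem_map.1 (Multiset.mem_coe.1 hc)
    intro hnil
    have := (Cycle.coe_eq_nil (l := l.map lab)).1 hnil
    exact hne l hl (List.map_eq_nil_iff.1 this)

end Trace

end FaceTracing

/-! ### Local structure of a layer -/

namespace DoublyHexagonal

open FaceTracing

/-- The directed edges with an end in a given layer, as codes: `0, 1, 2` lead up to the next layer
(from `a`, `c`, `d`), `3, 4, 5` are their reverses, `6, 7, 8` come up from the previous layer
(to `a`, `b`, `d`), `9, 10, 11` are their reverses, and `12, …, 17` are
`ab, ba, bc, cb, cd, dc` in the layer itself. A directed edge starts at the vertex `(k, v)`, which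
means the vertex `v` of the previous (`k = 0`), the given (`k = 1`) or the next (`k = 2`) layer. -/
def codeTail : Fin 18 → ℕ × Fin 4 :=
  ![(1, 0), (1, 2), (1, 3), (2, 0), (2, 1), (2, 3), (0, 0), (0, 2), (0, 3),
    (1, 0), (1, 1), (1, 3), (1, 0), (1, 1), (1, 1), (1, 2), (1, 2), (1, 3)]

/-- The end vertex of a coded directed edge; see `codeTail`. -/
def codeHead : Fin 18 → ℕ × Fin 4 :=
  ![(2, 0), (2, 1), (2, 3), (1, 0), (1, 2), (1, 3), (1, 0), (1, 1), (1, 3),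
    (0, 0), (0, 2), (0, 3), (1, 1), (1, 0), (1, 2), (1, 1), (1, 3), (1, 2)]

/-- The three directed edges leaving a vertex of an inner layer. -/
def outCode : Fin 4 → Fin 3 → Fin 18 :=
  ![![12, 0, 9], ![13, 14, 10], ![15, 16, 1], ![17, 2, 11]]

/-- The reverses of the directed edges `outCode`. -/
def inCode : Fin 4 → Fin 3 → Fin 18 :=
  ![![13, 3, 6], ![12, 15, 7], ![14, 17, 4], ![16, 5, 8]]

/-- The directed edges leading up to the next layer. -/
def upCode : Fin 3 → Fin 18 := ![0, 1, 2]

/-- The directed edges leading down from the next layer. -/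
def downCode : Fin 3 → Fin 18 := ![3, 4, 5]

/-- The directed edges leading up from the previous layer. -/
def upCode' : Fin 3 → Fin 18 := ![6, 7, 8]

/-- The directed edges leading down to the previous layer. -/
def downCode' : Fin 3 → Fin 18 := ![9, 10, 11]

/-- The indices of the edges present at a vertex of a layer that has a previous layer iff `lo` and
a next layer iff `hi`. -/
def slots (lo hi : Bool) (v : Fin 4) : List (Fin 3) :=
  [0, 1, 2].filter fun k =>
    ((codeHead (outCode v k)).1 = 0 → lo) ∧ ((codeHead (outCode v k)).1 = 2 → hi)

/-- The pairs of cyclically consecutive entries of `l`, read forwards or backwards. -/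
def cyclicPairs {α : Type*} (b : Bool) (l : List α) : List (α × α) :=
  let o := if b then l else l.reverse
  o.zip (o.rotate 1)

/-- The face traversal at the vertices of a layer, if the rotation at `v` is oriented by `β v`. -/
def layerPairs (lo hi : Bool) (β : Fin 4 → Bool) : List (Fin 18 × Fin 18) :=
  (List.finRange 4).flatMap fun v =>
    (cyclicPairs (β v) (slots lo hi v)).map fun e => (inCode v e.1, outCode v e.2)

/-- The six states: the face traversal of a lower part of the chain matches the edges leading down
into it with the edges leading up from it by one of these bijections. -/
def stateMap : Fin 6 → Fin 3 → Fin 3 :=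
  ![![0, 1, 2], ![0, 2, 1], ![1, 0, 2], ![1, 2, 0], ![2, 0, 1], ![2, 1, 0]]

/-- The first returns below a layer, if the lower part of the chain is in state `s`. -/
def statePairs (s : Fin 6) : List (Fin 18 × Fin 18) :=
  (List.finRange 3).map fun k => (downCode' k, upCode' (stateMap s k))

/-- The first returns through the lowest layer. -/
def firstContract (β : Fin 4 → Bool) : List (Fin 18 × Fin 18) × ℕ :=
  contractAt [12, 13, 14, 15, 16, 17] (layerPairs false true β)

/-- The first returns through an inner layer and everything below it. -/
def midContract (s : Fin 6) (β : Fin 4 → Bool) : List (Fin 18 × Fin 18) × ℕ :=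
  contractAt [6, 7, 8, 9, 10, 11, 12, 13, 14, 15, 16, 17]
    (layerPairs true true β ++ statePairs s)

/-- The first returns, to the directed edges starting in the last layer, through the rest of the
chain. -/
def lastContract (s : Fin 6) (β : Fin 4 → Bool) : List (Fin 18 × Fin 18) × ℕ :=
  contractAt [6, 7, 8] (layerPairs true false β ++ statePairs s)

/-- The state that can be read off from the first returns of the edges leading down. -/
def readState (l : List (Fin 18 × Fin 18)) : Fin 6 :=
  ((List.finRange 6).find? fun s => ∀ k, (downCode k, upCode (stateMap s k)) ∈ l).getD 0

/-- The state of the lowest layer. -/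
def startState (b : Bool) : Fin 6 := readState (firstContract fun _ => b).1

/-- The state after the next layer. -/
def nextState (s : Fin 6) (β : Fin 4 → Bool) : Fin 6 := readState (midContract s β).1

/-- The largest number of facial walks meeting the next layer if that layer is the last one. Only
its parity is forced; this choice makes all contributions to the genus natural numbers. -/
def stateFaces : Fin 6 → ℕ := ![1, 2, 2, 3, 3, 2]

/-- The contribution of an inner layer to the genus: such a layer increases the number of edges
minus the number of vertices by two. The subtractions and the division are exact, see
`midContract_spec`. -/
def stepGenus (s : Fin 6) (β : Fin 4 → Bool) : ℕ :=
  (2 + stateFaces s - stateFaces (nextState s β) - (midContract s β).2) / 2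

/-- The facial walks meeting the last layer, as cyclic sequences of directed edges that start in it,
if the layers before it are in state `s` and `b` is the orientation at its only vertex of degree
three. -/
def lastCycles : Fin 6 → Bool → List (List (Fin 18)) := fun s b =>
  (![![[[9, 12, 10, 14, 16, 11, 17, 15, 13]],
      [[9, 12, 14, 16, 11, 17, 15, 10, 13]]],
    ![[[9, 12, 10, 17, 15, 13], [11, 14, 16]],
      [[9, 12, 14, 16, 11, 13], [10, 17, 15]]],
    ![[[9, 14, 16, 11, 17, 15, 13], [10, 12]],
      [[9, 13], [10, 12, 14, 16, 11, 17, 15]]],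
    ![[[9, 14, 16, 11, 12, 10, 17, 15, 13]],
      [[9, 13], [10, 17, 15], [11, 12, 14, 16]]],
    ![[[9, 17, 15, 13], [10, 12], [11, 14, 16]],
      [[9, 17, 15, 10, 12, 14, 16, 11, 13]]],
    ![[[9, 17, 15, 13], [10, 14, 16, 11, 12]],
      [[9, 17, 15, 10, 13], [11, 12, 14, 16]]]] : Fin 6 → Fin 2 → List (List (Fin 18))) s
    (if b then 1 else 0)

/-- The type of an embedding whose last layer has the orientation `b` and whose other layers are in
state `s`. -/
def lastType : Fin 6 → Bool → Fin 6 := fun s b =>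
  (![![4, 4], ![1, 1], ![3, 3], ![5, 0], ![0, 5], ![2, 2]] : Fin 6 → Fin 2 → Fin 6) s
    (if b then 1 else 0)

/-- The contribution of the last layer to the genus; the operations are exact, see
`lastContract_spec`. -/
def lastGenus (s : Fin 6) (b : Bool) : ℕ := (stateFaces s - (lastCycles s b).length) / 2

theorem stateFaces_startState (b : Bool) : stateFaces (startState b) = 3 := by
  revert b; decide +kernel

theorem firstContract_spec (b : Bool) : (firstContract fun _ => b).2 = 0 ∧
    ∀ k, (downCode k, upCode (stateMap (startState b) k)) ∈ (firstContract fun _ => b).1 := by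
  revert b; decide +kernel

/-- Euler's formula for an inner layer, and the first returns that define the next state. -/
theorem midContract_spec (s : Fin 6) (β : Fin 4 → Bool) :
    (midContract s β).2 + stateFaces (nextState s β) + 2 * stepGenus s β = 2 + stateFaces s ∧
    ∀ k, (downCode k, upCode (stateMap (nextState s β) k)) ∈ (midContract s β).1 := by
  revert s β; decide +kernel

/-- The codes of the directed edges that start in the last layer. -/
def lastCodes : List (Fin 18) := [9, 10, 11, 12, 13, 14, 15, 16, 17]

/-- In the last layer no facial walk is closed up outside `S`, and `lastCycles` lists each directed
edge that starts in this layer once, in the order of first returns. -/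
theorem lastContract_spec (s : Fin 6) (b : Bool) :
    (lastContract s fun _ => b).2 = 0 ∧
    (∀ l ∈ lastCycles s b, ∀ hne : l ≠ [], (l ++ [l.head hne]).IsChain fun x y =>
      (x, y) ∈ (lastContract s fun _ => b).1) ∧
    (lastCycles s b).flatten.Perm lastCodes ∧
    (lastCycles s b).length + 2 * lastGenus s b = stateFaces s ∧
    ∀ l ∈ lastCycles s b, l ≠ [] := by
  revert s b; decide +kernel

theorem lastCycles_type (s : Fin 6) (b : Bool) :
    let τ : Multiset (Cycle (Fin 4)) :=
      ((lastCycles s b).map fun l => Cycle.ofList (l.map fun x => (codeTail x).2) : List _)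
    τ = stype (lastType s b) ∨ τ = (stype (lastType s b)).map Cycle.reverse := by
  revert s b; decide +kernel

theorem stype_injective (i j : Fin 6)
    (h : stype i = stype j ∨ stype i = (stype j).map Cycle.reverse) : i = j := by
  revert i j; decide +kernel

end DoublyHexagonal

/-! ### Rotations at vertices of degree two and three -/

theorem DoublyHexagonal.exists_mem_cyclicPairs {α : Type*} (b : Bool) {l : List α} {x : α}
    (hx : x ∈ l) : ∃ y, (x, y) ∈ cyclicPairs b l := by
  have key : ∀ o : List α, x ∈ o → ∃ y, (x, y) ∈ o.zip (o.rotate 1) := by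
    intro o ho
    obtain ⟨k, hk, rfl⟩ := List.mem_iff_getElem.1 ho
    have hk' : k < (o.zip (o.rotate 1)).length := by simpa using hk
    refine ⟨(o.rotate 1)[k]'(by simpa using hk), List.mem_iff_getElem.2 ⟨k, hk', ?_⟩⟩
    simp
  cases b
  · exact key _ (by simpa using hx)
  · exact key _ hx

theorem DoublyHexagonal.cyclicPairs_map {α β : Type*} (b : Bool) (g : α → β) (l : List α) :
    cyclicPairs b (l.map g) = (cyclicPairs b l).map fun e => (g e.1, g e.2) := by
  cases b <;> simp [cyclicPairs, ← List.map_reverse, ← List.map_rotate, List.zip_map, Prod.map_def]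

namespace SimpleGraph.RotationSystem

open DoublyHexagonal

variable {V : Type*} {G : SimpleGraph V}

/-- In the rotation at `v`, the edge `vu` is followed by the edge `vw`. -/
def Turns (P : G.RotationSystem) (v u w : V) : Prop :=
  ∃ h : G.Adj v u, (P.rot v ⟨u, h⟩ : V) = w

theorem Turns.unique {P : G.RotationSystem} {v u w w' : V} (h : P.Turns v u w)
    (h' : P.Turns v u w') : w = w' := by
  obtain ⟨_, rfl⟩ := h
  obtain ⟨_, rfl⟩ := h'
  rfl

theorem Turns.faceNext_eq {P : G.RotationSystem} {d d' : G.Dart} (h : P.Turns d.snd d.fst d'.snd)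
    (hd : d.snd = d'.fst) : P.faceNext d = d' := by
  obtain ⟨_, h⟩ := h
  apply Dart.ext
  exact Prod.ext hd h

theorem faceNext_injective (P : G.RotationSystem) : Function.Injective P.faceNext := by
  rintro ⟨⟨u, v⟩, h⟩ ⟨⟨u', v'⟩, h'⟩ heq
  have h1 : v = v' := congrArg (fun d : G.Dart => d.fst) heq
  subst h1
  have h2 : (P.rot v ⟨u, h.symm⟩ : V) = P.rot v ⟨u', h'.symm⟩ :=
    congrArg (fun d : G.Dart => d.snd) heq
  have h3 := (P.rot v).injective (Subtype.ext h2)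
  have h4 : u = u' := congrArg Subtype.val h3
  subst h4
  rfl

/-- A cyclic permutation of two or three neighbours is a given cyclic order of them, read forwards
or backwards. -/
theorem turns_of_length (P : G.RotationSystem) {v : V} {l : List V} (hl : l.Nodup)
    (hadj : ∀ w, G.Adj v w ↔ w ∈ l) (hlen : l.length = 2 ∨ l.length = 3) (b : Bool)
    (hb : ∀ x y z, l = [x, y, z] → (b = true ↔ P.Turns v x y)) :
    ∀ e ∈ cyclicPairs b l, P.Turns v e.1 e.2 := by
  have hne : ∀ u w, P.Turns v u w → w ≠ u := by
    rintro u w ⟨h, rfl⟩ heq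
    have hnt : (Set.univ : Set (G.neighborSet v)).Nontrivial := by
      obtain ⟨x, y, t, rfl⟩ : ∃ x y t, l = x :: y :: t := by
        rcases l with _ | ⟨x, _ | ⟨y, t⟩⟩ <;> simp at hlen ⊢
      refine ⟨⟨x, (hadj x).2 (by simp)⟩, trivial, ⟨y, (hadj y).2 (by simp)⟩, trivial, ?_⟩
      intro he
      have : x = y := congrArg Subtype.val he
      simp [this] at hl
    exact (P.cyclic v).apply_ne hnt (Set.mem_univ _) (Subtype.ext heq)
  have hinj : ∀ u u' w, P.Turns v u w → P.Turns v u' w → u = u' := by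
    rintro u u' w ⟨h, rfl⟩ ⟨h', he⟩
    exact (congrArg Subtype.val ((P.rot v).injective (Subtype.ext he))).symm
  have hex : ∀ u ∈ l, ∃ w ∈ l, P.Turns v u w := fun u hu =>
    ⟨P.rot v ⟨u, (hadj u).2 hu⟩, (hadj _).1 (P.rot v ⟨u, (hadj u).2 hu⟩).2, (hadj u).2 hu, rfl⟩
  rcases hlen with hlen | hlen
  · obtain ⟨x, y, rfl⟩ := List.length_eq_two.1 hlen
    obtain ⟨x', hx', hx⟩ := hex x (by simp)
    obtain ⟨y', hy', hy⟩ := hex y (by simp)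
    have := hne _ _ hx
    have := hne _ _ hy
    cases b <;> simp [cyclicPairs] <;> grind
  · obtain ⟨x, y, z, rfl⟩ := List.length_eq_three.1 hlen
    obtain ⟨x', hx', hx⟩ := hex x (by simp)
    obtain ⟨y', hy', hy⟩ := hex y (by simp)
    obtain ⟨z', hz', hz⟩ := hex z (by simp)
    have h1 := hne _ _ hx
    have h2 := hne _ _ hy
    have h3 := hne _ _ hz
    have h4 := hb x y z rfl
    have h5 : P.Turns v x y → x' = y := fun h => hx.unique h
    have hxy : x' ≠ y' := fun h => by
      have := hinj _ _ _ hx (h ▸ hy); simp [this] at hl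
    have hxz : x' ≠ z' := fun h => by
      have := hinj _ _ _ hx (h ▸ hz); simp [this] at hl
    have hyz : y' ≠ z' := fun h => by
      have := hinj _ _ _ hy (h ▸ hz); simp [this] at hl
    simp only [List.mem_cons, List.not_mem_nil, or_false] at hx' hy' hz'
    cases b
    · have hx1 : x' = z := by
        rcases hx' with rfl | rfl | rfl
        · exact absurd rfl h1
        · exact absurd (h4.2 hx) (by simp)
        · rfl
      subst hx1
      have hz1 : z' = y := by grind
      have hy1 : y' = x := by grind
      subst hz1 hy1
      simp [cyclicPairs, hx, hy, hz]
    · have hx1 : x' = y := h5 (h4.1 rfl)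
      subst hx1
      have hz1 : z' = x := by grind
      have hy1 : y' = z := by grind
      subst hz1 hy1
      simp [cyclicPairs, hx, hy, hz]

/-- Either cyclic order of two or three neighbours is the rotation of a cyclic permutation. -/
theorem exists_rot [DecidableEq V] {v : V} {l : List V} (hl : l.Nodup)
    (hadj : ∀ w, G.Adj v w ↔ w ∈ l) (hlen : l.length = 2 ∨ l.length = 3) (b : Bool) :
    ∃ r : Equiv.Perm (G.neighborSet v), r.IsCycleOn Set.univ ∧
      ∀ x y z, l = [x, y, z] → ∀ h : G.Adj v x, (b = true ↔ (r ⟨x, h⟩ : V) = y) := by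
  have key : ∀ l : List V, l.Nodup → (∀ w, G.Adj v w ↔ w ∈ l) →
      ∃ l' : List (G.neighborSet v), l'.map Subtype.val = l ∧ l'.formPerm.IsCycleOn Set.univ := by
    intro l hl hadj
    have hmem : ∀ w ∈ l, w ∈ G.neighborSet v := fun w hw => (hadj w).2 hw
    have hval : (l.pmap Subtype.mk hmem).map Subtype.val = l := by simp [List.map_pmap]
    refine ⟨l.pmap Subtype.mk hmem, hval, ?_⟩
    have hnd : (l.pmap Subtype.mk hmem).Nodup := List.Nodup.of_map Subtype.val (by rwa [hval])
    convert hnd.isCycleOn_formPerm using 1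
    ext ⟨w, hw⟩
    simpa [List.mem_pmap] using (hadj w).1 hw
  cases b
  · obtain ⟨l', h1, h2⟩ := key l.reverse (by simpa using hl) (by simpa using hadj)
    refine ⟨_, h2, fun x y z hxyz h => ?_⟩
    subst hxyz
    obtain ⟨Z, Y, W, rfl⟩ := List.length_eq_three.1
      (show l'.length = 3 by simpa using congrArg List.length h1)
    obtain ⟨rfl, rfl, rfl⟩ : (Z : V) = z ∧ (Y : V) = y ∧ (W : V) = x := by simpa using h1
    have hyz : Y ≠ Z := fun h => by simp [h] at hl
    have hxy : W ≠ Y := fun h => by simp [h] at hl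
    have hxz : W ≠ Z := fun h => by simp [h] at hl
    have : [Z, Y, W].formPerm W = Z := by
      simp [List.formPerm_cons_cons]
    change _ ↔ ([Z, Y, W].formPerm W : V) = Y
    rw [this]
    simpa using fun h => hyz (Subtype.ext h.symm)
  · obtain ⟨l', h1, h2⟩ := key l hl hadj
    refine ⟨_, h2, fun x y z hxyz h => ?_⟩
    subst hxyz
    obtain ⟨W, Y, Z, rfl⟩ := List.length_eq_three.1
      (show l'.length = 3 by simpa using congrArg List.length h1)
    obtain ⟨rfl, rfl, rfl⟩ : (W : V) = x ∧ (Y : V) = y ∧ (Z : V) = z := by simpa using h1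
    have hyz : Y ≠ Z := fun h => by simp [h] at hl
    have hxy : W ≠ Y := fun h => by simp [h] at hl
    have hxz : W ≠ Z := fun h => by simp [h] at hl
    have : [W, Y, Z].formPerm W = Y := by
      simp [List.formPerm_cons_cons, Equiv.swap_apply_def, hxy, hxz]
    change _ ↔ ([W, Y, Z].formPerm W : V) = Y
    rw [this]
    simp

end SimpleGraph.RotationSystem

/-! ### The layers of the chain -/

namespace DoublyHexagonal

open FaceTracing SimpleGraph

variable {n : ℕ}

/-- The vertex `c.2` of layer `i + c.1 - 1`, as in `codeTail`. -/
def place (n i : ℕ) (c : ℕ × Fin 4) : Fin (n + 1) × Fin 4 :=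
  (⟨min (i + c.1 - 1) n, by omega⟩, c.2)

/-- The neighbours of the vertex `v` of layer `i`. -/
def neighbours (n i : ℕ) (v : Fin 4) : List (Fin (n + 1) × Fin 4) :=
  (slots (1 ≤ i) (i < n) v).map fun k => place n i (codeHead (outCode v k))

theorem mem_slots {lo hi : Bool} {v : Fin 4} {k : Fin 3} : k ∈ slots lo hi v ↔
    ((codeHead (outCode v k)).1 = 0 → lo) ∧ ((codeHead (outCode v k)).1 = 2 → hi) := by
  revert lo hi v k; decide

theorem adj_place_iff {i : ℕ} (hi : i ≤ n) (v : Fin 4) (w : Fin (n + 1) × Fin 4) :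
    (chain n).Adj (place n i (1, v)) w ↔ w ∈ neighbours n i v := by
  obtain ⟨⟨j, hj⟩, u⟩ := w
  have hmin : min i n = i := by omega
  have h1 : ∀ v u : Fin 4, ((v : ℕ) + 1 = u ∨ (u : ℕ) + 1 = v) ↔
      ∃ k, codeHead (outCode v k) = (1, u) := by decide
  have h2 : ∀ v u : Fin 4, Link v u ↔ ∃ k, codeHead (outCode v k) = (2, u) := by decide
  have h0 : ∀ v u : Fin 4, Link u v ↔ ∃ k, codeHead (outCode v k) = (0, u) := by decide
  have hle : ∀ (v : Fin 4) k, (codeHead (outCode v k)).1 ≤ 2 := by decide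
  simp only [neighbours, List.mem_map, mem_slots, chain, place, Fin.mk.injEq,
    Nat.add_sub_cancel, hmin, decide_eq_true_eq, Prod.mk.injEq]
  constructor
  · rintro (⟨hij, h⟩ | ⟨hij, h⟩ | ⟨hij, h⟩)
    · obtain ⟨k, hk⟩ := (h1 v u).1 h
      exact ⟨k, by simp [hk], by simp [hk]; omega⟩
    · obtain ⟨k, hk⟩ := (h2 v u).1 h
      exact ⟨k, by simp [hk]; omega, by simp [hk]; omega⟩
    · obtain ⟨k, hk⟩ := (h0 v u).1 h
      exact ⟨k, by simp [hk]; omega, by simp [hk]; omega⟩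
  · rintro ⟨k, ⟨hk0, hk2⟩, hk, rfl⟩
    have := hle v k
    rcases h : codeHead (outCode v k) with ⟨c, u⟩
    rw [h] at hk hk0 hk2 this
    simp only at hk hk0 hk2 this
    interval_cases c
    · exact Or.inr (Or.inr ⟨by simp at hk0; omega, (h0 v u).2 ⟨k, h⟩⟩)
    · exact Or.inl ⟨by omega, (h1 v u).2 ⟨k, h⟩⟩
    · exact Or.inr (Or.inl ⟨by simp at hk2; omega, (h2 v u).2 ⟨k, h⟩⟩)

theorem nodup_neighbours {i : ℕ} (hi : i ≤ n) (v : Fin 4) :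
    (neighbours n i v).Nodup := by
  by_cases h1 : 1 ≤ i <;> by_cases h2 : i < n <;> fin_cases v <;>
    simp [neighbours, slots, place, codeHead, outCode, h1, h2,
      Prod.ext_iff, Fin.ext_iff] <;> omega

theorem length_neighbours (hn : 1 ≤ n) {i : ℕ} (v : Fin 4) :
    (neighbours n i v).length = 2 ∨ (neighbours n i v).length = 3 := by
  have : ∀ lo hi : Bool, (lo || hi) = true → ∀ v, (slots lo hi v).length = 2 ∨
      (slots lo hi v).length = 3 := by decide
  rw [neighbours, List.length_map]
  exact this _ _ (by simp; omega) v

theorem place_eq_self {i : ℕ} (p : Fin (n + 1) × Fin 4) (h : (p.1 : ℕ) = i) :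
    p = place n i (1, p.2) := by
  obtain ⟨⟨j, hj⟩, u⟩ := p
  simp [place, Prod.ext_iff, Fin.ext_iff] at *
  omega

open Classical in
/-- The orientation of the rotation at the vertex `v` of layer `i`; it is meaningful if that vertex
has degree three. -/
noncomputable def orientation (P : (chain n).RotationSystem) (i : ℕ) (v : Fin 4) : Bool :=
  decide (P.Turns (place n i (1, v)) (place n i (codeHead (outCode v 0)))
    (place n i (codeHead (outCode v 1))))

theorem slots_length_three {lo hi : Bool} {v : Fin 4} (h : (slots lo hi v).length = 3) :
    slots lo hi v = [0, 1, 2] := by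
  revert lo hi v; decide

theorem orientation_iff (P : (chain n).RotationSystem) {i : ℕ} {v : Fin 4}
    {x y z : Fin (n + 1) × Fin 4} (h : neighbours n i v = [x, y, z]) :
    orientation P i v = true ↔ P.Turns (place n i (1, v)) x y := by
  have h3 := slots_length_three (lo := 1 ≤ i) (hi := i < n) (v := v) (by
    have := congrArg List.length h
    simpa [neighbours] using this)
  rw [neighbours, h3] at h
  simp only [List.map_cons, List.map_nil, List.cons.injEq] at h
  rw [← h.1, ← h.2.1, orientation]
  exact @decide_eq_true_iff _ (Classical.propDecidable _)

theorem turns_of_orientation (hn : 1 ≤ n) (P : (chain n).RotationSystem) {i : ℕ} (hi : i ≤ n)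
    (v : Fin 4) (b : Bool) (hb : (slots (1 ≤ i) (i < n) v).length = 3 → b = orientation P i v) :
    ∀ e ∈ cyclicPairs b (neighbours n i v), P.Turns (place n i (1, v)) e.1 e.2 := by
  refine P.turns_of_length (nodup_neighbours hi v) (adj_place_iff hi v)
    (length_neighbours hn v) b fun x y z h => ?_
  rw [hb, orientation_iff P h]
  have := congrArg List.length h
  simpa [neighbours] using this

/-- Embeddings with the same orientations at the vertices of degree three are equal. -/
theorem eq_of_orientation (hn : 1 ≤ n) {P P' : (chain n).RotationSystem}
    (h : ∀ i ≤ n, ∀ v, (slots (1 ≤ i) (i < n) v).length = 3 →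
      orientation P i v = orientation P' i v) : P = P' := by
  have key : P.rot = P'.rot := by
    funext p
    refine Equiv.ext fun ⟨u, hu⟩ => Subtype.ext ?_
    obtain ⟨i, hi, v, rfl⟩ : ∃ i ≤ n, ∃ v, p = place n i (1, v) :=
      ⟨p.1, by omega, p.2, place_eq_self p rfl⟩
    obtain ⟨w, hw⟩ := exists_mem_cyclicPairs (orientation P i v)
      ((adj_place_iff hi v u).1 hu)
    have h1 := turns_of_orientation hn P hi v _ (fun _ => rfl) _ hw
    have h2 := turns_of_orientation hn P' hi v _ (h i hi v) _ hw
    obtain ⟨_, h1⟩ := h1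
    obtain ⟨_, h2⟩ := h2
    exact h1.trans h2.symm
  cases P; cases P'; cases key; rfl

/-- All orientations at the vertices of degree three occur. -/
theorem exists_orientation (hn : 1 ≤ n) (β : ℕ → Fin 4 → Bool) :
    ∃ P : (chain n).RotationSystem, ∀ i ≤ n, ∀ v, (slots (1 ≤ i) (i < n) v).length = 3 →
      orientation P i v = β i v := by
  have : ∀ p : Fin (n + 1) × Fin 4, ∃ r : Equiv.Perm ((chain n).neighborSet p),
      r.IsCycleOn Set.univ ∧ ∀ x y z, neighbours n p.1 p.2 = [x, y, z] →
        ∀ h : (chain n).Adj p x, (β p.1 p.2 = true ↔ (r ⟨x, h⟩ : Fin (n + 1) × Fin 4) = y) := by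
    intro p
    have hi : (p.1 : ℕ) ≤ n := by omega
    refine RotationSystem.exists_rot (nodup_neighbours hi p.2) (fun w => ?_)
      (length_neighbours hn p.2) _
    rw [← adj_place_iff hi, ← place_eq_self p rfl]
  choose r hr hr' using this
  refine ⟨⟨r, hr⟩, fun i hi v h3 => ?_⟩
  have hp1 : ((place n i (1, v)).1 : ℕ) = i := by simp [place]; omega
  obtain ⟨x, y, z, hxyz⟩ := List.length_eq_three.1
    (show (neighbours n i v).length = 3 by simpa [neighbours] using h3)
  have hadj : (chain n).Adj (place n i (1, v)) x :=
    (adj_place_iff hi v x).2 (by simp [hxyz])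
  have := hr' (place n i (1, v)) x y z (by rw [hp1]; exact hxyz) hadj
  rw [hp1] at this
  rw [Bool.eq_iff_iff, orientation_iff _ hxyz]
  exact ⟨fun ⟨_, h⟩ => this.2 h, fun h => ⟨hadj, this.1 h⟩⟩

end DoublyHexagonal

/-! ### Sweeping the chain layer by layer -/

namespace DoublyHexagonal

open FaceTracing SimpleGraph

variable {n : ℕ}

/-- The code stands for a directed edge of a layer that has a previous layer iff `lo` and a next
layer iff `hi`. -/
def Present (lo hi : Bool) (x : Fin 18) : Prop :=
  ((codeTail x).1 = 0 ∨ (codeHead x).1 = 0 → lo) ∧ ((codeTail x).1 = 2 ∨ (codeHead x).1 = 2 → hi)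

instance (lo hi : Bool) : DecidablePred (Present lo hi) := fun x => by
  unfold Present; infer_instance

theorem adj_of_present {i : ℕ} (hi : i ≤ n) {x : Fin 18}
    (hx : Present (1 ≤ i) (i < n) x) :
    (chain n).Adj (place n i (codeTail x)) (place n i (codeHead x)) := by
  have key : ∀ x : Fin 18, ∃ v k, x = outCode v k ∨ x = inCode v k := by decide
  have hout : ∀ v k, codeTail (outCode v k) = (1, v) := by decide
  have hin : ∀ v k, codeHead (inCode v k) = (1, v) ∧
      codeTail (inCode v k) = codeHead (outCode v k) := by decide
  obtain ⟨v, k, rfl | rfl⟩ := key x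
  · rw [hout, adj_place_iff hi]
    exact List.mem_map.2 ⟨k, mem_slots.2 ⟨fun h => hx.1 (Or.inr h), fun h => hx.2 (Or.inr h)⟩, rfl⟩
  · rw [(hin v k).1, (hin v k).2]
    refine ((adj_place_iff hi _ _).2 ?_).symm
    rw [Present, (hin v k).2] at hx
    exact List.mem_map.2 ⟨k, mem_slots.2 ⟨fun h => hx.1 (Or.inl h), fun h => hx.2 (Or.inl h)⟩, rfl⟩

open Classical in
/-- The directed edge with a given code at layer `i` (an arbitrary one if there is none). -/
noncomputable def codeDart (n i : ℕ) (x : Fin 18) : (chain n).Dart :=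
  if h : (chain n).Adj (place n i (codeTail x)) (place n i (codeHead x)) then ⟨(_, _), h⟩
  else ⟨((0, 0), (0, 1)), by simp [chain]⟩

theorem codeDart_ends {i : ℕ} (hi : i ≤ n) {x : Fin 18} (hx : Present (1 ≤ i) (i < n) x) :
    (codeDart n i x).fst = place n i (codeTail x) ∧
      (codeDart n i x).snd = place n i (codeHead x) := by
  rw [codeDart, dif_pos (adj_of_present hi hx)]
  exact ⟨rfl, rfl⟩

theorem place_injOn {i : ℕ} (hi : i ≤ n) {c c' : ℕ × Fin 4} (hc : c.1 ≤ 2) (hc' : c'.1 ≤ 2)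
    (h0 : c.1 = 0 → 1 ≤ i) (h0' : c'.1 = 0 → 1 ≤ i) (h2 : c.1 = 2 → i < n)
    (h2' : c'.1 = 2 → i < n) (h : place n i c = place n i c') : c = c' := by
  simp only [place, Prod.mk.injEq, Fin.mk.injEq] at h
  refine Prod.ext ?_ h.2
  omega

theorem code_le_two (x : Fin 18) : (codeTail x).1 ≤ 2 ∧ (codeHead x).1 ≤ 2 := by
  revert x; decide

theorem codeDart_injOn {i : ℕ} (hi : i ≤ n) :
    Set.InjOn (codeDart n i) {x | Present (1 ≤ i) (i < n) x} := by
  intro x hx y hy h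
  have hinj : ∀ x y : Fin 18, codeTail x = codeTail y → codeHead x = codeHead y → x = y := by
    decide +kernel
  have hx' := codeDart_ends hi hx
  have hy' := codeDart_ends hi hy
  have h1 := code_le_two x
  have h2 := code_le_two y
  simp only [Set.mem_ofPred_eq, Present, decide_eq_true_eq] at hx hy
  apply hinj
  · exact place_injOn hi h1.1 h2.1 (fun h => hx.1 (Or.inl h)) (fun h => hy.1 (Or.inl h))
      (fun h => hx.2 (Or.inl h)) (fun h => hy.2 (Or.inl h)) (by rw [← hx'.1, ← hy'.1, h])
  · exact place_injOn hi h1.2 h2.2 (fun h => hx.1 (Or.inr h)) (fun h => hy.1 (Or.inr h))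
      (fun h => hx.2 (Or.inr h)) (fun h => hy.2 (Or.inr h)) (by rw [← hx'.2, ← hy'.2, h])

theorem exists_codeDart {i : ℕ} (hi : i ≤ n) (d : (chain n).Dart)
    (hd : (d.fst.1 : ℕ) = i ∨ (d.snd.1 : ℕ) = i) :
    ∃ x, Present (1 ≤ i) (i < n) x ∧ codeDart n i x = d := by
  have hp : ∀ (lo hi : Bool) v k, k ∈ slots lo hi v →
      Present lo hi (outCode v k) ∧ Present lo hi (inCode v k) := by decide
  have hout : ∀ v k, codeTail (outCode v k) = (1, v) := by decide
  have hin : ∀ v k, codeHead (inCode v k) = (1, v) ∧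
      codeTail (inCode v k) = codeHead (outCode v k) := by decide
  rcases hd with hd | hd
  · have hadj := d.adj
    have hfst := place_eq_self d.fst hd
    change (chain n).Adj d.fst d.snd at hadj
    rw [hfst, adj_place_iff hi] at hadj
    obtain ⟨k, hk, hk'⟩ := List.mem_map.1 hadj
    have hpr := (hp _ _ _ _ hk).1
    refine ⟨_, hpr, Dart.ext _ _ (Prod.ext ?_ ?_)⟩
    · exact (codeDart_ends hi hpr).1.trans (by rw [hout]; exact hfst.symm)
    · exact (codeDart_ends hi hpr).2.trans hk'
  · have hadj := d.adj.symm
    have hsnd := place_eq_self d.snd hd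
    change (chain n).Adj d.snd d.fst at hadj
    rw [hsnd, adj_place_iff hi] at hadj
    obtain ⟨k, hk, hk'⟩ := List.mem_map.1 hadj
    have hpr := (hp _ _ _ _ hk).2
    refine ⟨_, hpr, Dart.ext _ _ (Prod.ext ?_ ?_)⟩
    · exact (codeDart_ends hi hpr).1.trans (by rw [(hin _ _).2]; exact hk')
    · exact (codeDart_ends hi hpr).2.trans (by rw [(hin _ _).1]; exact hsnd.symm)

theorem present_of_mem_layerPairs {lo hi : Bool} {β : Fin 4 → Bool} {e : Fin 18 × Fin 18}
    (he : e ∈ layerPairs lo hi β) :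
    Present lo hi e.1 ∧ Present lo hi e.2 := by
  have : ∀ lo hi β, (layerPairs lo hi β).all
      (fun e => Present lo hi e.1 ∧ Present lo hi e.2) = true := by decide +kernel
  simpa using List.all_eq_true.1 (this lo hi β) e he

theorem faceNext_codeDart (hn : 1 ≤ n) (P : (chain n).RotationSystem) {i : ℕ} (hi : i ≤ n)
    {β : Fin 4 → Bool}
    (hβ : ∀ v, (slots (1 ≤ i) (i < n) v).length = 3 → β v = orientation P i v)
    {e : Fin 18 × Fin 18} (he : e ∈ layerPairs (1 ≤ i) (i < n) β) :
    P.faceNext (codeDart n i e.1) = codeDart n i e.2 := by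
  have hout : ∀ v k, codeTail (outCode v k) = (1, v) := by decide
  have hin : ∀ v k, codeHead (inCode v k) = (1, v) ∧
      codeTail (inCode v k) = codeHead (outCode v k) := by decide
  have hpr := present_of_mem_layerPairs he
  obtain ⟨v, -, he⟩ := List.mem_flatMap.1 he
  obtain ⟨⟨k, k'⟩, hk, rfl⟩ := List.mem_map.1 he
  have h1 := codeDart_ends hi hpr.1
  have h2 := codeDart_ends hi hpr.2
  simp only [hin, hout] at h1 h2
  apply RotationSystem.Turns.faceNext_eq
  · rw [h1.1, h1.2, h2.2]
    refine turns_of_orientation hn P hi v (β v) (hβ v)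
      (place n i (codeHead (outCode v k)), place n i (codeHead (outCode v k'))) ?_
    rw [neighbours, cyclicPairs_map]
    exact List.mem_map.2 ⟨_, hk, rfl⟩
  · rw [h1.2, h2.1]

/-- The directed edges with both ends in layers before layer `i`. -/
def before (n i : ℕ) : Set (chain n).Dart := {d | (d.fst.1 : ℕ) < i ∧ (d.snd.1 : ℕ) < i}

theorem codeDart_notMem_before {i : ℕ} (hi : i ≤ n) {x : Fin 18}
    (hx : Present (1 ≤ i) (i < n) x) : codeDart n i x ∉ before n i := by
  have h : ∀ x : Fin 18, (codeTail x).1 = 1 ∨ (codeHead x).1 = 1 := by decide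
  rintro ⟨h1, h2⟩
  rw [(codeDart_ends hi hx).1] at h1
  rw [(codeDart_ends hi hx).2] at h2
  simp only [place] at h1 h2
  have := h x
  omega

theorem before_succ {i : ℕ} (hi : i ≤ n) {xs : List (Fin 18)}
    (hxs : ∀ x, x ∈ xs ↔ Present (1 ≤ i) false x) :
    before n (i + 1) = before n i ∪ codeDart n i '' {x | x ∈ xs} := by
  have hmono : ∀ x, x ∈ xs → Present (1 ≤ i) (i < n) x := fun x hx =>
    ⟨((hxs x).1 hx).1, fun h => by simpa using ((hxs x).1 hx).2 h⟩
  ext d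
  constructor
  · rintro ⟨h1, h2⟩
    by_cases hd : (d.fst.1 : ℕ) = i ∨ (d.snd.1 : ℕ) = i
    · obtain ⟨x, hx, rfl⟩ := exists_codeDart hi d hd
      refine Or.inr ⟨x, (hxs x).2 ⟨hx.1, fun h => ?_⟩, rfl⟩
      have hlt : i < n := by simpa using hx.2 h
      rw [(codeDart_ends hi hx).1] at h1
      rw [(codeDart_ends hi hx).2] at h2
      simp only [place] at h1 h2
      omega
    · exact Or.inl ⟨by omega, by omega⟩
  · rintro (⟨h1, h2⟩ | ⟨x, hx, rfl⟩)
    · exact ⟨by omega, by omega⟩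
    · have h := (hxs x).1 hx
      have he := codeDart_ends hi (hmono x hx)
      have hle := code_le_two x
      have h2 := h.2
      simp only [Bool.false_eq_true, imp_false, not_or] at h2
      refine ⟨?_, ?_⟩
      · rw [he.1]; simp only [place]; omega
      · rw [he.2]; simp only [place]; omega

/-- What is needed to know of the layers up to layer `i` for continuing the face traversal: the
state `s` and the number `k` of facial walks that do not leave these layers. -/
structure StateAt (P : (chain n).RotationSystem) (i : ℕ) (s : Fin 6) (k : ℕ) : Prop where
  reach : ∀ j, Reach P.faceNext (before n (i + 1)) (codeDart n i (downCode j))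
    (codeDart n i (upCode (stateMap s j)))
  ncard : (closedOrbits P.faceNext (before n (i + 1))).ncard = k

theorem codeDart_succ {i : ℕ} (j : Fin 3) :
    codeDart n (i + 1) (downCode' j) = codeDart n i (downCode j) ∧
      codeDart n (i + 1) (upCode' j) = codeDart n i (upCode j) := by
  constructor <;> fin_cases j <;> rfl

theorem records_first (hn : 1 ≤ n) (P : (chain n).RotationSystem) {β : Fin 4 → Bool}
    (hβ : ∀ v, (slots false true v).length = 3 → β v = orientation P 0 v) :
    Records P.faceNext (codeDart n 0) (before n 0) (layerPairs false true β) := by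
  have h0 : (decide (1 ≤ 0)) = false := rfl
  have h1 : (decide (0 < n)) = true := by simpa using Nat.lt_of_lt_of_le Nat.zero_lt_one hn
  have hpr : ∀ e ∈ layerPairs false true β, Present (1 ≤ 0) (0 < n) e.1 ∧
      Present (1 ≤ 0) (0 < n) e.2 := by
    rw [h0, h1]; exact fun e he => present_of_mem_layerPairs he
  have hnd : ∀ β, ((layerPairs false true β).map Prod.fst).Nodup := by decide +kernel
  refine ⟨fun e he => ?_, ?_, fun e he => codeDart_notMem_before (Nat.zero_le n) (hpr e he).1,
    fun e he => codeDart_notMem_before (Nat.zero_le n) (hpr e he).2⟩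
  · rw [← faceNext_codeDart hn P (Nat.zero_le n) (β := β) (by rwa [h0, h1]) (by rwa [h0, h1])]
    exact Reach.single _ _ _
  · rw [show (fun e : Fin 18 × Fin 18 => codeDart n 0 e.1) = codeDart n 0 ∘ Prod.fst from rfl,
      ← List.map_map]
    refine List.Nodup.map_on ?_ (hnd β)
    intro x hx y hy hxy
    obtain ⟨e, he, rfl⟩ := List.mem_map.1 hx
    obtain ⟨e', he', rfl⟩ := List.mem_map.1 hy
    exact codeDart_injOn (Nat.zero_le n) (hpr e he).1 (hpr e' he').1 hxy

theorem present_of_mem_append {hi : Bool} {s : Fin 6} {β : Fin 4 → Bool}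
    {e : Fin 18 × Fin 18} (he : e ∈ layerPairs true hi β ++ statePairs s) :
    Present true hi e.1 ∧ Present true hi e.2 := by
  rcases List.mem_append.1 he with he | he
  · exact present_of_mem_layerPairs he
  · have : ∀ hi s, (statePairs s).all
        (fun e => Present true hi e.1 ∧ Present true hi e.2) = true := by decide +kernel
    simpa using List.all_eq_true.1 (this hi s) e he

theorem records_succ (P : (chain n).RotationSystem) {i : ℕ} (hi : i + 1 ≤ n)
    {s : Fin 6} {k : ℕ} (hs : StateAt P i s k) {β : Fin 4 → Bool}
    (hβ : ∀ v, (slots true (i + 1 < n) v).length = 3 → β v = orientation P (i + 1) v) :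
    Records P.faceNext (codeDart n (i + 1)) (before n (i + 1))
      (layerPairs true (i + 1 < n) β ++ statePairs s) := by
  have h0 : (decide (1 ≤ i + 1)) = true := by simp
  have hpr : ∀ e ∈ layerPairs true (i + 1 < n) β ++ statePairs s,
      Present (1 ≤ i + 1) (i + 1 < n) e.1 ∧ Present (1 ≤ i + 1) (i + 1 < n) e.2 := by
    rw [h0]; exact fun e he => present_of_mem_append he
  have hnd : ∀ hi s β, ((layerPairs true hi β ++ statePairs s).map Prod.fst).Nodup := by
    decide +kernel
  refine ⟨fun e he => ?_, ?_, fun e he => codeDart_notMem_before hi (hpr e he).1,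
    fun e he => codeDart_notMem_before hi (hpr e he).2⟩
  · rcases List.mem_append.1 he with he | he
    · rw [← faceNext_codeDart (by omega) P hi (β := β) (by rwa [h0]) (by rwa [h0])]
      exact Reach.single _ _ _
    · obtain ⟨j, -, rfl⟩ := List.mem_map.1 he
      simp only [(codeDart_succ _).1, (codeDart_succ _).2]
      exact hs.reach j
  · rw [show (fun e : Fin 18 × Fin 18 => codeDart n (i + 1) e.1) = codeDart n (i + 1) ∘ Prod.fst
      from rfl, ← List.map_map]
    refine List.Nodup.map_on ?_ (hnd _ s β)
    intro x hx y hy hxy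
    obtain ⟨e, he, rfl⟩ := List.mem_map.1 hx
    obtain ⟨e', he', rfl⟩ := List.mem_map.1 hy
    exact codeDart_injOn hi (hpr e he).1 (hpr e' he').1 hxy

theorem before_zero : before n 0 = ∅ := by
  ext d; simp [before]

theorem source_first (β : Fin 4 → Bool) : ∀ x ∈ ([12, 13, 14, 15, 16, 17] : List (Fin 18)),
    x ∈ (layerPairs false true β).map Prod.fst := by
  revert β; decide +kernel

theorem source_mid (s : Fin 6) (β : Fin 4 → Bool) :
    ∀ x ∈ ([6, 7, 8, 9, 10, 11, 12, 13, 14, 15, 16, 17] : List (Fin 18)),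
      x ∈ (layerPairs true true β ++ statePairs s).map Prod.fst := by
  revert s β; decide +kernel

theorem source_last (s : Fin 6) (β : Fin 4 → Bool) : ∀ x ∈ ([6, 7, 8] : List (Fin 18)),
    x ∈ (layerPairs true false β ++ statePairs s).map Prod.fst := by
  revert s β; decide +kernel

theorem stateAt_zero (hn : 1 ≤ n) (P : (chain n).RotationSystem) :
    StateAt P 0 (startState (orientation P 0 2)) 0 := by
  set b := orientation P 0 2
  have h1 : (decide (0 < n)) = true := by simpa using Nat.lt_of_lt_of_le Nat.zero_lt_one hn
  have hβ : ∀ v, (slots false true v).length = 3 → (fun _ => b) v = orientation P 0 v := by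
    intro v hv
    have : ∀ v, (slots false true v).length = 3 → v = 2 := by decide
    rw [this v hv]
  have hspec := contractAt_spec P.faceNext_injective (codeDart_injOn (Nat.zero_le n))
    [12, 13, 14, 15, 16, 17]
    (fun e he => by rw [h1]; exact present_of_mem_layerPairs he) (records_first hn P hβ)
    (source_first _)
  rw [← before_succ (Nat.zero_le n) (by decide), before_zero] at hspec
  have hc := firstContract_spec b
  rw [firstContract] at hc
  refine ⟨fun j => hspec.1.reach (_, _) (hc.2 j), hspec.2.trans ?_⟩
  rw [closedOrbits_empty P.faceNext_injective, Set.ncard_empty, zero_add]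
  exact hc.1

theorem StateAt.succ {P : (chain n).RotationSystem} {i : ℕ} (hi : i + 1 < n)
    {s : Fin 6} {k : ℕ} (hs : StateAt P i s k) :
    StateAt P (i + 1) (nextState s (orientation P (i + 1)))
      (k + (midContract s (orientation P (i + 1))).2) := by
  have h1 : (decide (i + 1 < n)) = true := by simpa using hi
  have h0 : (decide (1 ≤ i + 1)) = true := by simp
  have hrec := records_succ P hi.le hs (β := orientation P (i + 1)) fun _ _ => rfl
  rw [h1] at hrec
  have hspec := contractAt_spec P.faceNext_injective (codeDart_injOn hi.le)
    [6, 7, 8, 9, 10, 11, 12, 13, 14, 15, 16, 17]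
    (fun e he => by rw [h1, h0]; exact present_of_mem_append he) hrec (source_mid _ _)
  rw [← before_succ hi.le (by rw [h0]; decide)] at hspec
  have hc := (midContract_spec s (orientation P (i + 1))).2
  refine ⟨fun j => ?_, hspec.2.trans ?_⟩
  · have := hc j
    rw [midContract] at this
    exact hspec.1.reach
      (downCode j, upCode (stateMap (nextState s (orientation P (i + 1))) j)) this
  · rw [hs.ncard, midContract]

/-- The trace of the last layer and the number of facial walks. -/
theorem StateAt.last {m : ℕ} {P : (chain (m + 1)).RotationSystem} {s : Fin 6} {k : ℕ}
    (hs : StateAt P m s k) :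
    P.facialWalks.card = k + (lastCycles s (orientation P (m + 1) 1)).length ∧
      IsOfType (m + 1) (lastType s (orientation P (m + 1) 1)) P := by
  set b := orientation P (m + 1) 1
  have h1 : (decide (m + 1 < m + 1)) = false := by simp
  have h0 : (decide (1 ≤ m + 1)) = true := by simp
  have hβ : ∀ v, (slots true false v).length = 3 → (fun _ => b) v = orientation P (m + 1) v := by
    intro v hv
    have : ∀ v, (slots true false v).length = 3 → v = 1 := by decide
    rw [this v hv]
  have hrec := records_succ P le_rfl hs (β := fun _ => b) (by rwa [h1])
  rw [h1] at hrec
  have hspec := contractAt_spec P.faceNext_injective (codeDart_injOn le_rfl) [6, 7, 8]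
    (fun e he => by rw [h1, h0]; exact present_of_mem_append he) hrec (source_last _ _)
  have hinj := codeDart_injOn (n := m + 1) le_rfl
  rw [h0, h1] at hinj
  have hends : ∀ x, Present true false x → (codeDart (m + 1) (m + 1) x).fst =
      place (m + 1) (m + 1) (codeTail x) := fun x hx =>
    (codeDart_ends le_rfl (by rwa [h0, h1])).1
  have hlast : ∀ x ∈ lastCodes, Present true false x ∧ (codeTail x).1 = 1 := by decide
  -- what has been passed over by now are the directed edges that do not start in `S`
  have hU : before (m + 1) (m + 1) ∪ codeDart (m + 1) (m + 1) '' {x | x ∈ [6, 7, 8]} =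
      {d | name (m + 1) d.fst = none} := by
    have hname : ∀ d : (chain (m + 1)).Dart, name (m + 1) d.fst = none ↔
        (d.fst.1 : ℕ) < m + 1 := by
      intro d
      simp only [name, ite_eq_right_iff, reduceCtorEq, imp_false, Fin.ext_iff, Fin.val_last]
      omega
    ext d
    simp only [Set.mem_union, Set.mem_ofPred_eq, hname]
    constructor
    · rintro (h | ⟨x, hx, rfl⟩)
      · exact h.1
      · have : ∀ x ∈ ([6, 7, 8] : List (Fin 18)), Present true false x ∧ (codeTail x).1 = 0 := by
          decide
        rw [hends x (this x hx).1]
        simp only [place, (this x hx).2]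
        omega
    · intro h
      by_cases h2 : (d.snd.1 : ℕ) = m + 1
      · obtain ⟨x, hx, rfl⟩ := exists_codeDart le_rfl d (Or.inr h2)
        rw [h0, h1] at hx
        refine Or.inr ⟨x, ?_, rfl⟩
        have hcode : ∀ x, Present true false x → (codeTail x).1 ≠ 0 →
            (codeTail x).1 = 1 := by decide
        by_contra hne
        have hcode' : ∀ x, Present true false x → (codeTail x).1 = 0 →
          x ∈ ([6, 7, 8] : List (Fin 18)) := by decide
        have h3 := hcode x hx fun h => hne (hcode' x hx h)
        rw [hends x hx] at h
        simp only [place, h3] at h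
        omega
      · exact Or.inl ⟨h, by have := d.snd.1.2; omega⟩
  rw [hU] at hspec
  obtain ⟨hc1, hc2, hc3, hc4, hc5⟩ := lastContract_spec s b
  rw [lastContract] at hc1 hc2
  have hmem : ∀ x ∈ (lastCycles s b).flatten, x ∈ lastCodes := fun x hx => hc3.mem_iff.1 hx
  obtain ⟨hcard, htr⟩ := orbits_trace (f := P.faceNext) (L := codeDart (m + 1) (m + 1))
    (nm := fun d => name (m + 1) d.fst) (lab := fun x => (codeTail x).2) P.faceNext_injective
    (W := P.facialWalks) (fun c => by simp [RotationSystem.facialWalks])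
    (cs := lastCycles s b) hc5
    (fun l hl => (hc2 l hl (hc5 l hl)).imp fun x y hxy => hspec.1.reach (x, y) hxy)
    (fun x hx => by
      have := hlast x (hmem x hx)
      rw [hends x this.1]
      simp [name, place, this.2, Fin.ext_iff])
    (by
      refine List.Nodup.map_on (fun x hx y hy hxy => ?_) (hc3.nodup_iff.2 (by decide))
      exact hinj (hlast x (hmem x hx)).1 (hlast y (hmem y hy)).1 hxy)
    (fun d hd => by
      have hd' : (d.fst.1 : ℕ) = m + 1 := by
        by_contra hne
        refine hd ?_
        simp only [name, ite_eq_right_iff, reduceCtorEq, imp_false, Fin.ext_iff, Fin.val_last]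
        exact hne
      obtain ⟨x, hx, rfl⟩ := exists_codeDart le_rfl d (Or.inl hd')
      rw [h0, h1] at hx
      refine List.mem_map.2 ⟨x, hc3.mem_iff.2 ?_, rfl⟩
      have hcode : ∀ x, Present true false x → (codeTail x).1 = 1 → x ∈ lastCodes := by decide
      refine hcode x hx ?_
      rw [hends x hx] at hd'
      simp only [place] at hd'
      have := code_le_two x
      have h2 := hx.2
      simp only [Bool.false_eq_true, imp_false, not_or] at h2
      omega)
  constructor
  · have hk : (closedOrbits P.faceNext {d | name (m + 1) d.fst = none}).ncard = k := by
      rw [hspec.2, hs.ncard, hc1, add_zero]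
    rwa [hk] at hcard
  · have htraces := htr
    rw [← RotationSystem.traces] at htraces
    have := lastCycles_type s b
    simp only at this
    rw [← htraces] at this
    exact this

end DoublyHexagonal

/-! ### Summation over all embeddings -/

namespace SimpleGraph

open Classical in
/-- Generating functions can be computed as sums over any parametrization of the embeddings. -/
theorem genusGenFun_eq_sum {V : Type*} [Fintype V] [DecidableEq V] {G : SimpleGraph V}
    [DecidableRel G.Adj] {ι : Type*} [Fintype ι] (e : G.RotationSystem ≃ ι) {γ : ι → ℕ}
    (hγ : ∀ P, P.genus = γ (e P)) {p : G.RotationSystem → Prop} {q : ι → Prop}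
    (hq : ∀ P, p P ↔ q (e P)) :
    G.genusGenFun p = ∑ x, if q x then (X : ℤ[X]) ^ γ x else 0 := by
  ext g
  rw [genusGenFun_coeff, finsetSum_coeff]
  have h1 : ∀ x, (if q x then (X : ℤ[X]) ^ γ x else 0).coeff g =
      if γ x = g ∧ q x then 1 else 0 := by
    intro x
    by_cases hx : q x <;> simp [hx, coeff_X_pow, eq_comm]
  simp only [h1, Finset.sum_boole]
  congr 1
  rw [← Fintype.card_subtype, ← Nat.card_eq_fintype_card]
  refine Nat.card_congr (e.subtypeEquiv fun P => ?_)
  rw [hγ, hq, Nat.cast_inj]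

end SimpleGraph

namespace DoublyHexagonal

open FaceTracing SimpleGraph Matrix

theorem card_edgeFinset_chain (n : ℕ) : (chain n).edgeFinset.card = 6 * n + 3 := by
  have h := (chain n).sum_degrees_eq_twice_card_edges
  have hdeg : ∀ i : Fin (n + 1), ∀ v, (chain n).degree (i, v) =
      (slots (1 ≤ (i : ℕ)) ((i : ℕ) < n) v).length := by
    intro i v
    have hi : (i : ℕ) ≤ n := by omega
    have : (chain n).neighborFinset (i, v) = (neighbours n i v).toFinset := by
      ext w
      rw [mem_neighborFinset, List.mem_toFinset, ← adj_place_iff hi, ← place_eq_self (i, v) rfl]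
    rw [← card_neighborFinset_eq_degree, this, List.toFinset_card_of_nodup (nodup_neighbours hi v),
      neighbours, List.length_map]
  have hsum : ∀ lo hi : Bool, ∑ v, (slots lo hi v).length =
      6 + (if lo then 3 else 0) + (if hi then 3 else 0) := by decide
  rw [Fintype.sum_prod_type] at h
  simp only [hdeg, hsum, Finset.sum_add_distrib] at h
  have h1 : ∑ i : Fin (n + 1), (if decide (1 ≤ (i : ℕ)) = true then 3 else 0) = 3 * n := by
    rw [Fin.sum_univ_succ]
    simp [Nat.mul_comm]
  have h2 : ∑ i : Fin (n + 1), (if decide ((i : ℕ) < n) = true then 3 else 0) = 3 * n := by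
    rw [Fin.sum_univ_castSucc]
    simp [Nat.mul_comm]
  rw [h1, h2] at h
  simp at h
  omega

/-- The state and the genus contributed so far after the inner layers with orientations `w`, if the
orientation in the lowest layer is `b`. -/
def run (b : Bool) : (m : ℕ) → (Fin m → Fin 4 → Bool) → Fin 6 × ℕ
  | 0, _ => (startState b, 0)
  | m + 1, w =>
    let r := run b m (Fin.init w)
    (nextState r.1 (w (Fin.last m)), r.2 + stepGenus r.1 (w (Fin.last m)))

/-- The state of the face traversal of `P` after layer `i` and the genus contributed up to there. -/
noncomputable def layerRun {n : ℕ} (P : (chain n).RotationSystem) (i : ℕ) : Fin 6 × ℕ :=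
  run (orientation P 0 2) i fun j => orientation P (j + 1)

theorem layerRun_succ {n : ℕ} (P : (chain n).RotationSystem) (i : ℕ) :
    layerRun P (i + 1) = (nextState (layerRun P i).1 (orientation P (i + 1)),
      (layerRun P i).2 + stepGenus (layerRun P i).1 (orientation P (i + 1))) := rfl

/-- The Euler characteristic is accounted for layer by layer: the closed facial walks, those still
counted by the state and twice the genus add up to `2 * i + 3`. -/
theorem exists_stateAt_layerRun {m : ℕ} (P : (chain (m + 1)).RotationSystem) (i : ℕ) (hi : i ≤ m) :
    ∃ k, StateAt P i (layerRun P i).1 k ∧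
      k + stateFaces (layerRun P i).1 + 2 * (layerRun P i).2 = 2 * i + 3 := by
  induction i with
  | zero =>
    refine ⟨0, stateAt_zero (by omega) P, ?_⟩
    simp [layerRun, run, stateFaces_startState]
  | succ i ih =>
    obtain ⟨k, hk, hg⟩ := ih (by omega)
    have h := (midContract_spec (layerRun P i).1 (orientation P (i + 1))).1
    rw [layerRun_succ]
    exact ⟨_, hk.succ (by omega), by simp only; omega⟩

/-- The orientations at the vertices of degree three: those of the inner layers, the one at `c` in
the lowest layer, and the one at `b` in the last layer. -/
abbrev Orientations (m : ℕ) : Type := (Fin m → Fin 4 → Bool) × Bool × Bool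

/-- The genus of the embedding with the given orientations. -/
def orientationsGenus {m : ℕ} (x : Orientations m) : ℕ :=
  (run x.2.1 m x.1).2 + lastGenus (run x.2.1 m x.1).1 x.2.2

/-- The type of the embedding with the given orientations. -/
def orientationsType {m : ℕ} (x : Orientations m) : Fin 6 :=
  lastType (run x.2.1 m x.1).1 x.2.2

/-- An embedding of the chain is determined by the orientations at its vertices of degree three,
and these are arbitrary. -/
noncomputable def orientationsEquiv (m : ℕ) : (chain (m + 1)).RotationSystem ≃ Orientations m :=
  Equiv.ofBijective (fun P => (fun j => orientation P (j + 1), orientation P 0 2,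
    orientation P (m + 1) 1)) (by
    constructor
    · intro P P' h
      simp only [Prod.mk.injEq] at h
      obtain ⟨h1, h2, h3⟩ := h
      refine eq_of_orientation (by omega) fun i hi v hv => ?_
      rcases i with _ | i
      · have : ∀ v, (slots false true v).length = 3 → v = 2 := by decide
        rw [this v (by simpa using hv), h2]
      · rcases (show i ≤ m by omega).lt_or_eq with hi' | rfl
        · exact congrFun (congrFun h1 ⟨i, hi'⟩) v
        · have : ∀ v, (slots true false v).length = 3 → v = 1 := by decide
          rw [this v (by simpa using hv), h3]
    · rintro ⟨w, b, b'⟩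
      obtain ⟨P, hP⟩ := exists_orientation (n := m + 1) (by omega) fun i =>
        if i = 0 then fun _ => b else if h : i - 1 < m then w ⟨i - 1, h⟩ else fun _ => b'
      refine ⟨P, ?_⟩
      simp only [Prod.mk.injEq]
      refine ⟨?_, ?_, ?_⟩
      · funext j v
        have h1 : (slots true true v).length = 3 := by revert v; decide
        have := hP (j + 1) (by omega) v (by simpa using h1)
        simpa using this
      · have h1 : (slots false true 2).length = 3 := by decide
        simpa using hP 0 (by omega) 2 (by simpa using h1)
      · have h1 : (slots true false 1).length = 3 := by decide
        simpa using hP (m + 1) le_rfl 1 (by simpa using h1))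

theorem isOfType_unique {n : ℕ} {P : (chain n).RotationSystem} {i j : Fin 6}
    (hi : IsOfType n i P) (hj : IsOfType n j P) : i = j := by
  have hrr : ∀ τ : Multiset (Cycle (Fin 4)), (τ.map Cycle.reverse).map Cycle.reverse = τ := by
    intro τ
    simp [Multiset.map_map]
  apply stype_injective
  rcases hi with hi | hi <;> rcases hj with hj | hj
  · exact Or.inl (hi.symm.trans hj)
  · exact Or.inr (hi.symm.trans hj)
  · right
    rw [← hj, hi, hrr]
  · left
    rw [← hrr (stype i), ← hi, hj, hrr]

/-- The states predict the genus and the type of every embedding. -/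
theorem genus_and_type {m : ℕ} (P : (chain (m + 1)).RotationSystem) :
    P.genus = orientationsGenus (orientationsEquiv m P) ∧
      IsOfType (m + 1) (orientationsType (orientationsEquiv m P)) P := by
  obtain ⟨k, hk, hg⟩ := exists_stateAt_layerRun P m le_rfl
  obtain ⟨hcard, htype⟩ := hk.last
  refine ⟨?_, htype⟩
  have hlen := (lastContract_spec (layerRun P m).1 (orientation P (m + 1) 1)).2.2.2.1
  have hγ : orientationsGenus (orientationsEquiv m P) =
    (layerRun P m).2 + lastGenus (layerRun P m).1 (orientation P (m + 1) 1) := rfl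
  rw [RotationSystem.genus, card_edgeFinset_chain, hcard, hγ]
  have h : (k + (lastCycles (layerRun P m).1 (orientation P (m + 1) 1)).length +
      2 * ((layerRun P m).2 + lastGenus (layerRun P m).1 (orientation P (m + 1) 1)) : ℚ) =
        2 * m + 3 := by
    exact_mod_cast (by omega : k + (lastCycles (layerRun P m).1 (orientation P (m + 1) 1)).length +
      2 * ((layerRun P m).2 + lastGenus (layerRun P m).1 (orientation P (m + 1) 1)) = 2 * m + 3)
  simp only [Fintype.card_prod, Fintype.card_fin]
  push_cast
  linarith

theorem isOfType_iff {m : ℕ} (P : (chain (m + 1)).RotationSystem) (i : Fin 6) :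
    IsOfType (m + 1) i P ↔ orientationsType (orientationsEquiv m P) = i :=
  ⟨fun h => isOfType_unique (genus_and_type P).2 h, fun h => h ▸ (genus_and_type P).2⟩

theorem stratified_succ_eq_sum (m : ℕ) (i : Fin 6) : stratified (m + 1) i =
    ∑ x : Orientations m, if orientationsType x = i then X ^ orientationsGenus x else 0 := by
  rw [stratified, genusGenFun_eq_sum (orientationsEquiv m) (fun P => (genus_and_type P).1)
    (q := fun x => orientationsType x = i) fun P => isOfType_iff P i]
  exact Finset.sum_congr rfl fun x _ => by congr

theorem reduced_succ_eq_sum (m : ℕ) (j : Fin 4) :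
    reduced (m + 1) j = ∑ i ∈ merged j, stratified (m + 1) i := by
  simp only [stratified_succ_eq_sum]
  rw [Finset.sum_comm, reduced, genusGenFun_eq_sum (orientationsEquiv m)
    (fun P => (genus_and_type P).1) (q := fun x => orientationsType x ∈ merged j) fun P => by
      simp [isOfType_iff]]
  refine Finset.sum_congr rfl fun x _ => ?_
  rw [Finset.sum_ite_eq]
  congr

theorem genusPolynomial_succ_eq_sum (m : ℕ) :
    (chain (m + 1)).genusPolynomial = ∑ i, stratified (m + 1) i := by
  simp only [stratified_succ_eq_sum]
  rw [Finset.sum_comm, genusPolynomial, genusGenFun_eq_sum (orientationsEquiv m)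
    (fun P => (genus_and_type P).1) (q := fun _ => True) fun P => Iff.rfl]
  exact Finset.sum_congr rfl fun x _ => by simp

/-! ### The transfer matrices -/

/-- The contributions of the two orientations in the last layer, sorted by type, if the layers
before it are in state `s`. -/
noncomputable def lastVector (s : Fin 6) : Fin 6 → ℤ[X] := fun i =>
  ∑ b, if lastType s b = i then X ^ lastGenus s b else 0

theorem lastVector_eq (s : Fin 6) : lastVector s =
    (![![0, 0, 0, 0, 2, 0], ![0, 2, 0, 0, 0, 0], ![0, 0, 0, 2, 0, 0],
      ![1, 0, 0, 0, 0, X], ![1, 0, 0, 0, 0, X], ![0, 0, 2, 0, 0, 0]] : Fin 6 → Fin 6 → ℤ[X]) s := by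
  -- only the single facial walk of the last type falls short of the largest possible number
  have h : ∀ s b, lastGenus s b = if lastType s b = 5 then 1 else 0 := by decide +kernel
  funext i
  simp only [lastVector, h, Fintype.sum_bool, lastType]
  fin_cases s <;> fin_cases i <;> simp <;> norm_num

/-- The states that the sixteen orientations of an inner layer lead to from state `s`, together with
the contributions of that layer to the genus. -/
def stepMultiset : Fin 6 → Multiset (Fin 6 × ℕ) :=
  open Multiset in
  ![replicate 8 (3, 0) + replicate 8 (4, 0),
    replicate 4 (1, 1) + replicate 4 (2, 1) + replicate 2 (3, 0) + replicate 2 (4, 0) +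
      replicate 4 (5, 1),
    replicate 8 (1, 1) + replicate 4 (3, 0) + replicate 4 (4, 0),
    replicate 2 (0, 2) + replicate 3 (1, 1) + replicate 1 (2, 1) + replicate 1 (3, 0) +
      replicate 4 (3, 1) + replicate 4 (4, 1) + replicate 1 (5, 1),
    replicate 2 (0, 2) + replicate 3 (1, 1) + replicate 1 (2, 1) + replicate 4 (3, 1) +
      replicate 1 (4, 0) + replicate 4 (4, 1) + replicate 1 (5, 1),
    replicate 4 (1, 1) + replicate 4 (2, 1) + replicate 2 (3, 0) + replicate 2 (4, 0) +
      replicate 4 (5, 1)]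

theorem map_step (s : Fin 6) : (Finset.univ : Finset (Fin 4 → Bool)).val.map
    (fun β => (nextState s β, stepGenus s β)) = stepMultiset s := by
  revert s; decide +kernel

theorem sum_step {M : Type*} [AddCommMonoid M] (s : Fin 6) (φ : Fin 6 → ℕ → M) :
    ∑ β, φ (nextState s β) (stepGenus s β) = ((stepMultiset s).map fun p => φ p.1 p.2).sum := by
  rw [← map_step, Multiset.map_map]
  rfl

set_option maxHeartbeats 1000000 in
/-- Inserting an inner layer in front of the last one acts on the vector of types by `Q`. Although
the state is not a function of the type, the numbers of types of the extensions are. -/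
theorem sum_step_lastVector (s : Fin 6) :
    ∑ β, (X : ℤ[X]) ^ stepGenus s β • lastVector (nextState s β) = Q *ᵥ lastVector s := by
  rw [sum_step s fun t d => (X : ℤ[X]) ^ d • lastVector t]
  simp only [lastVector_eq]
  funext i
  fin_cases s <;> fin_cases i <;>
    simp [stepMultiset, Q, Matrix.mulVec, dotProduct, Fin.sum_univ_succ] <;> ring

/-- The stratified genus distribution, as a sum over the layers other than the last. -/
noncomputable def typeVector (m : ℕ) : Fin 6 → ℤ[X] :=
  ∑ w : Fin m → Fin 4 → Bool, ∑ b, (X : ℤ[X]) ^ (run b m w).2 • lastVector (run b m w).1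

theorem stratified_succ (m : ℕ) : stratified (m + 1) = typeVector m := by
  funext i
  rw [stratified_succ_eq_sum, Fintype.sum_prod_type, typeVector, Finset.sum_apply]
  refine Finset.sum_congr rfl fun w _ => ?_
  rw [Fintype.sum_prod_type, Finset.sum_apply]
  refine Finset.sum_congr rfl fun b _ => ?_
  simp only [Pi.smul_apply, lastVector, smul_eq_mul, Finset.mul_sum, mul_ite, mul_zero, ← pow_add]
  rfl

theorem typeVector_zero : typeVector 0 = ![2, 0, 0, 0, 0, 2 * X] := by
  have h1 : startState true = 4 := by decide +kernel
  have h2 : startState false = 3 := by decide +kernel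
  funext i
  simp only [typeVector, run, h1, h2, Fintype.sum_bool, lastVector_eq]
  fin_cases i <;> simp <;> ring

theorem typeVector_succ (m : ℕ) : typeVector (m + 1) = Q *ᵥ typeVector m := by
  rw [typeVector, typeVector, Matrix.mulVec_sum,
    ← (Fin.snocEquiv fun _ : Fin (m + 1) => Fin 4 → Bool).sum_comp, Fintype.sum_prod_type_right]
  refine Finset.sum_congr rfl fun w _ => ?_
  rw [Matrix.mulVec_sum, Finset.sum_comm]
  refine Finset.sum_congr rfl fun b _ => ?_
  rw [Matrix.mulVec_smul, ← sum_step_lastVector, Finset.smul_sum]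
  refine Finset.sum_congr rfl fun β _ => ?_
  have h1 : Fin.init (Fin.snocEquiv (fun _ : Fin (m + 1) => Fin 4 → Bool) (β, w)) = w :=
    Fin.init_snoc _ _
  have h2 : Fin.snocEquiv (fun _ : Fin (m + 1) => Fin 4 → Bool) (β, w) (Fin.last m) = β :=
    Fin.snoc_last (α := fun _ : Fin (m + 1) => Fin 4 → Bool) _ _
  simp only [run, h1, h2, pow_add, smul_smul]

theorem stratified_succ_eq_pow (m : ℕ) :
    stratified (m + 1) = Q ^ m *ᵥ ![2, 0, 0, 0, 0, 2 * X] := by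
  rw [stratified_succ]
  induction m with
  | zero => rw [typeVector_zero, pow_zero, Matrix.one_mulVec]
  | succ m ih => rw [typeVector_succ, ih, Matrix.mulVec_mulVec, pow_succ']

/-- Merging the types turns `Q` into `Qred`. -/
theorem sum_merged_mulVec (v : Fin 6 → ℤ[X]) :
    (fun j => ∑ i ∈ merged j, (Q *ᵥ v) i) = Qred *ᵥ fun j => ∑ i ∈ merged j, v i := by
  funext j
  fin_cases j <;>
    simp [merged, Q, Qred, Matrix.mulVec, dotProduct, Fin.sum_univ_succ] <;> ring

theorem reduced_succ_eq_pow (m : ℕ) : reduced (m + 1) = Qred ^ m *ᵥ ![2, 0, 0, 2 * X] := by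
  have h : ∀ m, reduced (m + 1) = fun j => ∑ i ∈ merged j, typeVector m i := fun m => by
    funext j
    rw [reduced_succ_eq_sum, stratified_succ]
  rw [h]
  induction m with
  | zero =>
    rw [typeVector_zero, pow_zero, Matrix.one_mulVec]
    funext j
    fin_cases j <;> simp [merged]
  | succ m ih => rw [typeVector_succ, sum_merged_mulVec, ih, Matrix.mulVec_mulVec, pow_succ']

theorem genusPolynomial_succ (m : ℕ) :
    (chain (m + 1)).genusPolynomial = ∑ j, reduced (m + 1) j := by
  rw [genusPolynomial_succ_eq_sum]
  simp only [reduced_succ_eq_sum, Fin.sum_univ_succ, merged]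
  simp
  ring

theorem Qred_mulVec (p q r s : ℤ[X]) : Qred *ᵥ ![p, q, r, s] =
    ![p + 2 * q + 4 * r + 8 * s, 8 * X * (p + q + r), X * (2 * p + 4 * q),
      X * ((4 * X + 1) * p + 2 * q + 4 * r + 8 * s)] := by
  funext j
  fin_cases j <;> simp [Qred, Matrix.mulVec, dotProduct, Fin.sum_univ_succ] <;> ring

end DoublyHexagonal

open Matrix in
theorem mainTheorem1 :
    (∀ n : ℕ, 1 ≤ n → ∀ P : (DoublyHexagonal.chain n).RotationSystem,
      ∃! i : Fin 6, DoublyHexagonal.IsOfType n i P) ∧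
    DoublyHexagonal.stratified 1 = ![2, 0, 0, 0, 0, 2 * X] ∧
    (∀ n : ℕ, 2 ≤ n →
      DoublyHexagonal.stratified n =
        (DoublyHexagonal.Q ^ (n - 1)) *ᵥ DoublyHexagonal.stratified 1) ∧
    (∀ n : ℕ, 1 ≤ n →
      DoublyHexagonal.reduced n = (DoublyHexagonal.Qred ^ (n - 1)) *ᵥ ![2, 0, 0, 2 * X]) ∧
    (∀ n : ℕ, 1 ≤ n →
      (DoublyHexagonal.chain n).genusPolynomial = ∑ j, DoublyHexagonal.reduced n j) ∧
    (DoublyHexagonal.chain 1).genusPolynomial = 2 + 2 * X ∧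
    (DoublyHexagonal.chain 2).genusPolynomial = 2 + 38 * X + 24 * X ^ 2 ∧
    (DoublyHexagonal.chain 3).genusPolynomial = 2 + 102 * X + 664 * X ^ 2 + 256 * X ^ 3 ∧
    (DoublyHexagonal.chain 4).genusPolynomial =
      2 + 166 * X + 3032 * X ^ 2 + 10368 * X ^ 3 + 2816 * X ^ 4 ∧
    (DoublyHexagonal.chain 5).genusPolynomial =
      2 + 230 * X + 7448 * X ^ 2 + 70912 * X ^ 3 + 152832 * X ^ 4 + 30720 * X ^ 5 ∧
    (DoublyHexagonal.chain 6).genusPolynomial =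
      2 + 294 * X + 13912 * X ^ 2 + 244096 * X ^ 3 + 1441536 * X ^ 4 + 2158592 * X ^ 5
        + 335872 * X ^ 6 ∧
    (DoublyHexagonal.chain 7).genusPolynomial =
      2 + 358 * X + 22424 * X ^ 2 + 595456 * X ^ 3 + 6588672 * X ^ 4 + 26675200 * X ^ 5
        + 29556736 * X ^ 6 + 3670016 * X ^ 7 ∧
    (DoublyHexagonal.chain 8).genusPolynomial =
      2 + 422 * X + 32984 * X ^ 2 + 1190528 * X ^ 3 + 20378368 * X ^ 4 + 155713536 * X ^ 5
        + 461266944 * X ^ 6 + 395051008 * X ^ 7 + 40108032 * X ^ 8 := by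
  have hpos : ∀ n : ℕ, 1 ≤ n → ∃ m, n = m + 1 := fun n hn => ⟨n - 1, by omega⟩
  have h1 : DoublyHexagonal.stratified 1 = ![2, 0, 0, 0, 0, 2 * X] := by
    rw [DoublyHexagonal.stratified_succ_eq_pow 0, pow_zero, Matrix.one_mulVec]
  refine ⟨?_, h1, ?_, ?_, ?_, ?_⟩
  · intro n hn P
    obtain ⟨m, rfl⟩ := hpos n hn
    exact ⟨_, (DoublyHexagonal.genus_and_type P).2, fun i hi =>
      DoublyHexagonal.isOfType_unique hi (DoublyHexagonal.genus_and_type P).2⟩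
  · intro n hn
    obtain ⟨m, rfl⟩ := hpos n (by omega)
    rw [h1, DoublyHexagonal.stratified_succ_eq_pow, Nat.add_sub_cancel]
  · intro n hn
    obtain ⟨m, rfl⟩ := hpos n hn
    rw [DoublyHexagonal.reduced_succ_eq_pow, Nat.add_sub_cancel]
  · intro n hn
    obtain ⟨m, rfl⟩ := hpos n hn
    exact DoublyHexagonal.genusPolynomial_succ m
  · have hpoly : ∀ {m : ℕ} {p q r s : ℤ[X]},
        DoublyHexagonal.Qred ^ m *ᵥ ![2, 0, 0, 2 * X] = ![p, q, r, s] →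
        (DoublyHexagonal.chain (m + 1)).genusPolynomial = p + q + r + s := by
      intro m p q r s h
      rw [DoublyHexagonal.genusPolynomial_succ, DoublyHexagonal.reduced_succ_eq_pow, h,
        Fin.sum_univ_four]
      rfl
    have hstep : ∀ {m : ℕ} {p q r s p' q' r' s' : ℤ[X]},
        DoublyHexagonal.Qred ^ m *ᵥ ![2, 0, 0, 2 * X] = ![p, q, r, s] →
        p + 2 * q + 4 * r + 8 * s = p' → 8 * X * (p + q + r) = q' → X * (2 * p + 4 * q) = r' →
        X * ((4 * X + 1) * p + 2 * q + 4 * r + 8 * s) = s' →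
        DoublyHexagonal.Qred ^ (m + 1) *ᵥ ![2, 0, 0, 2 * X] = ![p', q', r', s'] := by
      rintro m p q r s _ _ _ _ h rfl rfl rfl rfl
      rw [pow_succ', ← Matrix.mulVec_mulVec, h, DoublyHexagonal.Qred_mulVec]
    have v0 : DoublyHexagonal.Qred ^ 0 *ᵥ ![2, 0, 0, 2 * X] =
        ![2,
        0,
        0,
        2 * X] :=
      by rw [pow_zero, Matrix.one_mulVec]
    have v1 : DoublyHexagonal.Qred ^ 1 *ᵥ ![2, 0, 0, 2 * X] =
        ![2 + 16 * X,
        16 * X,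
        4 * X,
        2 * X + 24 * X ^ 2] :=
      hstep v0 (by ring) (by ring) (by ring) (by ring)
    have v2 : DoublyHexagonal.Qred ^ 2 *ᵥ ![2, 0, 0, 2 * X] =
        ![2 + 80 * X + 192 * X ^ 2,
        16 * X + 288 * X ^ 2,
        4 * X + 96 * X ^ 2,
        2 * X + 88 * X ^ 2 + 256 * X ^ 3] :=
      hstep v1 (by ring) (by ring) (by ring) (by ring)
    have v3 : DoublyHexagonal.Qred ^ 3 *ᵥ ![2, 0, 0, 2 * X] =
        ![2 + 144 * X + 1856 * X ^ 2 + 2048 * X ^ 3,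
        16 * X + 800 * X ^ 2 + 4608 * X ^ 3,
        4 * X + 224 * X ^ 2 + 1536 * X ^ 3,
        2 * X + 152 * X ^ 2 + 2176 * X ^ 3 + 2816 * X ^ 4] :=
      hstep v2 (by ring) (by ring) (by ring) (by ring)
    have v4 : DoublyHexagonal.Qred ^ 4 *ᵥ ![2, 0, 0, 2 * X] =
        ![2 + 208 * X + 5568 * X ^ 2 + 34816 * X ^ 3 + 22528 * X ^ 4,
        16 * X + 1312 * X ^ 2 + 23040 * X ^ 3 + 65536 * X ^ 4,
        4 * X + 352 * X ^ 2 + 6912 * X ^ 3 + 22528 * X ^ 4,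
        2 * X + 216 * X ^ 2 + 6144 * X ^ 3 + 42240 * X ^ 4 + 30720 * X ^ 5] :=
      hstep v3 (by ring) (by ring) (by ring) (by ring)
    have v5 : DoublyHexagonal.Qred ^ 5 *ᵥ ![2, 0, 0, 2 * X] =
        ![2 + 272 * X + 11328 * X ^ 2 + 157696 * X ^ 3 + 581632 * X ^ 4 + 245760 * X ^ 5,
        16 * X + 1824 * X ^ 2 + 57856 * X ^ 3 + 518144 * X ^ 4 + 884736 * X ^ 5,
        4 * X + 480 * X ^ 2 + 16384 * X ^ 3 + 161792 * X ^ 4 + 307200 * X ^ 5,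
        2 * X + 280 * X ^ 2 + 12160 * X ^ 3 +
          179968 * X ^ 4 + 720896 * X ^ 5 + 335872 * X ^ 6] :=
      hstep v4 (by ring) (by ring) (by ring) (by ring)
    have v6 : DoublyHexagonal.Qred ^ 6 *ᵥ ![2, 0, 0, 2 * X] =
        ![2 + 336 * X + 19136 * X ^ 2 + 436224 * X ^ 3 +
          3704832 * X ^ 4 + 9011200 * X ^ 5 + 2686976 * X ^ 6,
        16 * X + 2336 * X ^ 2 + 109056 * X ^ 3 +
          1855488 * X ^ 4 + 10092544 * X ^ 5 + 11501568 * X ^ 6,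
        4 * X + 608 * X ^ 2 + 29952 * X ^ 3 +
          546816 * X ^ 4 + 3235840 * X ^ 5 + 4030464 * X ^ 6,
        2 * X + 344 * X ^ 2 + 20224 * X ^ 3 + 481536 * X ^ 4 +
          4335616 * X ^ 5 + 11337728 * X ^ 6 + 3670016 * X ^ 7] :=
      hstep v5 (by ring) (by ring) (by ring) (by ring)
    have v7 : DoublyHexagonal.Qred ^ 7 *ᵥ ![2, 0, 0, 2 * X] =
        ![2 + 400 * X + 28992 * X ^ 2 + 935936 * X ^ 3 +
          13455360 * X ^ 4 + 76824576 * X ^ 5 + 132513792 * X ^ 6 + 29360128 * X ^ 7,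
        16 * X + 2848 * X ^ 2 + 176640 * X ^ 3 + 4601856 * X ^ 4 +
          48857088 * X ^ 5 + 178716672 * X ^ 6 + 145752064 * X ^ 7,
        4 * X + 736 * X ^ 2 + 47616 * X ^ 3 + 1308672 * X ^ 4 +
          14831616 * X ^ 5 + 58392576 * X ^ 6 + 51380224 * X ^ 7,
        2 * X + 408 * X ^ 2 + 30336 * X ^ 3 + 1012480 * X ^ 4 +
          15200256 * X ^ 5 + 91643904 * X ^ 6 + 168558592 * X ^ 7 + 40108032 * X ^ 8] :=
      hstep v6 (by ring) (by ring) (by ring) (by ring)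
    exact ⟨(hpoly v0).trans (by ring),
      (hpoly v1).trans (by ring),
      (hpoly v2).trans (by ring),
      (hpoly v3).trans (by ring),
      (hpoly v4).trans (by ring),
      (hpoly v5).trans (by ring),
      (hpoly v6).trans (by ring),
      (hpoly v7).trans (by ring)⟩
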